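/- All systems are finite-dimensional. For a tripartite state $\rho_{ABE}$ let $$K^{\rightarrow}(\rho_{ABE})=\sup_{Q,R}\bigl(I(X:B|T)_\omega-I(X:E|T)_\omega\bigr)$$ be its single-copy one-way key, where the supremum runs over all POVMs $Q=(Q_x)_{x\in\mathcal X}$ on $A$ with a finite outcome set $\mathcal X$ and all classical channels $R(t|x)$ from $\mathcal X$ to a finite alphabet $\mathcal T$, the information quantities refer to the state $$\omega_{TXBE}=\sum_{t,x}R(t|x)\,|t\rangle\langle t|\otimes|x\rangle\langle x|\otimes\operatorname{tr}_A\bigl(\rho_{ABE}(Q_x\otimes\mathbf 1_{BE})\bigr),$$ $I(X:Y|T)=S(XT)+S(YT)-S(T)-S(XYT)$, and $S(\sigma)=-\operatorname{tr}\sigma\log_2\sigma$ is the von Neumann entropy. For a bipartite state $\rho_{AB}$ write $K^{\rightarrow}(\rho_{AB}):=K^{\rightarrow}(|\psi\rangle\langle\psi|_{ABE})$, where $|\psi\rangle_{ABE}$ is any purification of $\rho_{AB}$, i.e. $\operatorname{tr}_E|\psi\rangle\langle\psi|=\rho_{AB}$. Let $\|M\|_1=\operatorname{tr}\sqrt{M^\dagger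 M}$ be the trace norm, $h(x)=-x\log_2x-(1-x)\log_2(1-x)$ the binary Shannon entropy, and $d_A$ the dimension of $A$. Lemma. Let $\rho_{AB}$ and $\widetilde\rho_{AB}$ be bipartite states on the same system with $\|\rho_{AB}-\widetilde\rho_{AB}\|_1\le\delta$, where $\delta\le\frac12$. Then, for every choice of the purifications (with possibly different purifying systems) of $\rho_{AB}$ and $\widetilde\rho_{AB}$, $$\bigl|K^{\rightarrow}(\rho_{AB})-K^{\rightarrow}(\widetilde\rho_{AB})\bigr|\le\bigl(4\delta+4\sqrt{2\delta}\bigr)\log_2d_A+2h(\delta)+2h\bigl(\sqrt{2\delta}\bigr).$$ -/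

import Mathlib

open scoped Matrix ComplexOrder

noncomputable section

namespace OneWayKey

/-- A quantum state: a positive semidefinite matrix of unit trace. -/
def IsState {n : Type*} [Fintype n] (ρ : Matrix n n ℂ) : Prop :=
  ρ.PosSemidef ∧ ρ.trace = 1

/-- The trace norm `‖M‖₁ = tr √(M† M)`, i.e. the sum of the singular values of `M`
(the square roots of the eigenvalues of `M† M`). -/
def traceNorm {n : Type*} [Fintype n] [DecidableEq n] (M : Matrix n n ℂ) : ℝ :=
  ∑ i, √((Matrix.isHermitian_conjTranspose_mul_self M).eigenvalues i)

open Classical in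
/-- The von Neumann entropy `S(ρ) = - tr ρ log₂ ρ = - ∑ λᵢ log₂ λᵢ`, with `λᵢ` the eigenvalues of
the Hermitian matrix `ρ` (the value on non-Hermitian matrices is irrelevant). -/
def entropy {n : Type*} [Fintype n] [DecidableEq n] (ρ : Matrix n n ℂ) : ℝ :=
  if h : ρ.IsHermitian then - ∑ i, h.eigenvalues i * Real.logb 2 (h.eigenvalues i) else 0

/-- The binary Shannon entropy `h(x) = - x log₂ x - (1 - x) log₂ (1 - x)`. -/
def binaryEntropy (x : ℝ) : ℝ :=
  - x * Real.logb 2 x - (1 - x) * Real.logb 2 (1 - x)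

/-- Partial trace over the last factor. -/
def traceLast {α γ : Type*} [Fintype γ] (M : Matrix (α × γ) (α × γ) ℂ) : Matrix α α ℂ :=
  Matrix.of fun i j => ∑ c, M (i, c) (j, c)

/-- Partial trace over the middle one of three factors. -/
def traceMid {α β γ : Type*} [Fintype β] (M : Matrix ((α × β) × γ) ((α × β) × γ) ℂ) :
    Matrix (α × γ) (α × γ) ℂ :=
  Matrix.of fun i j => ∑ b, M ((i.1, b), i.2) ((j.1, b), j.2)

/-- The conditional mutual information `I(X : Y | Z) = S(ZX) + S(ZY) - S(Z) - S(ZXY)` of a matrix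
on the system `ZXY`. -/
def condMutualInfo {Z X Y : Type*} [Fintype Z] [DecidableEq Z] [Fintype X] [DecidableEq X]
    [Fintype Y] [DecidableEq Y] (ω : Matrix ((Z × X) × Y) ((Z × X) × Y) ℂ) : ℝ :=
  entropy (traceLast ω) + entropy (traceMid ω) - entropy (traceLast (traceLast ω)) - entropy ω

/-- A POVM on the system `A` with outcomes in `X`. -/
def IsPOVM {A X : Type*} [Fintype A] [DecidableEq A] [Fintype X] (Q : X → Matrix A A ℂ) : Prop :=
  (∀ x, (Q x).PosSemidef) ∧ ∑ x, Q x = 1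

/-- A classical channel from `X` to `T`; `R x t` is the transition probability `R(t|x)`. -/
def IsClassicalChannel {X T : Type*} [Fintype T] (R : X → T → ℝ) : Prop :=
  (∀ x t, 0 ≤ R x t) ∧ ∀ x, ∑ t, R x t = 1

/-- The state
`ω_{TXBE} = ∑_{t,x} R(t|x) |t⟩⟨t| ⊗ |x⟩⟨x| ⊗ tr_A (ρ_{ABE} (Q_x ⊗ 1_{BE}))`
obtained when `A` is measured with `Q` and the outcome `x` is sent through `R`. The operators
`tr_A (ρ_{ABE} (Q_x ⊗ 1_{BE}))` are not normalized: their trace is the probability of `x`. -/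
def measuredState {A B E X T : Type*} [Fintype A] [DecidableEq X] [DecidableEq T]
    (ρ : Matrix ((A × B) × E) ((A × B) × E) ℂ) (Q : X → Matrix A A ℂ) (R : X → T → ℝ) :
    Matrix (((T × X) × B) × E) (((T × X) × B) × E) ℂ :=
  Matrix.of fun i j =>
    if i.1.1 = j.1.1 then
      (R i.1.1.2 i.1.1.1 : ℂ) *
        ∑ a, ∑ a', ρ ((a, i.1.2), i.2) ((a', j.1.2), j.2) * Q i.1.1.2 a' a
    else 0

/-- The (single-copy) one-way key `max_{Q; T|X} (I(X : B | T) - I(X : E | T))` of a tripartite state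
`ρ_{ABE}`, the optimization being over all POVMs `Q` on `A` with finitely many outcomes and all
classical channels from the outcome `X` to a finite alphabet `T`. -/
def oneWayKey {A B E : Type*} [Fintype A] [DecidableEq A] [Fintype B] [DecidableEq B]
    [Fintype E] [DecidableEq E] (ρ : Matrix ((A × B) × E) ((A × B) × E) ℂ) : ℝ :=
  sSup {r : ℝ | ∃ (m k : ℕ) (Q : Fin m → Matrix A A ℂ) (R : Fin m → Fin k → ℝ),
    IsPOVM Q ∧ IsClassicalChannel R ∧
      r = condMutualInfo (traceLast (measuredState ρ Q R))
        - condMutualInfo (traceMid (measuredState ρ Q R))}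

/-- The rank-one operator `|ψ⟩⟨ψ|`. -/
def ketbra {n : Type*} (ψ : n → ℂ) : Matrix n n ℂ :=
  Matrix.vecMulVec ψ (star ψ)

/-- `ψ` on `ABE` is a purification of `ρ` on `AB`: `tr_E |ψ⟩⟨ψ| = ρ`. -/
def IsPurification {A B E : Type*} [Fintype E] (ψ : (A × B) × E → ℂ)
    (ρ : Matrix (A × B) (A × B) ℂ) : Prop :=
  traceLast (ketbra ψ) = ρ

end OneWayKey

end

noncomputable section

namespace OneWayKey

open Matrix

/-! The environment can be eliminated. Fix a protocol and replace each effect by a Kraus operator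
`K` on `A` with that effect as `Kᴴ * K`, keeping system `A` afterwards. Conditioned on the classical
register `Z`, the state of `ABE` stays pure, so S(ZE) = S(ZBA) and S(ZB) - S(ZE) = -S(A|ZB). In
I(X:B|T) - I(X:E|T) the terms S(TX) and S(T) cancel, and the key value becomes S(A|TXB) - S(A|TB).
The two instruments, one with outcome (t,x) and one with outcome t, depend on the protocol alone.
Hence only ρ_AB matters, whatever the purification (`condMutualInfo_sub_eq`).

It remains to bound the change of S(A|ZB) uniformly in the size of `Z` and `B`, by the
Alicki–Fannes–Winter argument (`condEntropy_sub_le`). Write ρ - ρ' = P - N with P, N positive of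
trace at most δ/2, and push ρ + N = ρ' + P through the instrument. Concavity of the conditional
entropy on one side, and concavity up to a mixing term on the other, give δ log d_A + h(δ) for each
conditional entropy. The resulting 2δ log d_A + 2h(δ) is below the claimed bound.

Concavity of S(A|B), equivalent to strong subadditivity, is proved from scratch. S(A|B) is minus the
relative entropy of the operator to its marginal tensored with 1. Relative entropy is an integral of
quadratic forms, each a supremum of functionals linear in the pair of operators, so it is jointly
convex (`relEntropy_add_le`).

All operators are unnormalized, so convexity statements appear as sub- or superadditivity. -/

/-- The von Neumann entropy in nats, as a function of the roots of the characteristic polynomial. -/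
def natEntropy {n : Type*} [Fintype n] [DecidableEq n] (M : Matrix n n ℂ) : ℝ :=
  (M.charpoly.roots.map fun z => Real.negMulLog z.re).sum

/-! ### Diagonalization and entropy via the characteristic polynomial -/

section Spectral

variable {m n : Type*} [Fintype m] [DecidableEq m] [Fintype n] [DecidableEq n]

/-- `M` is diagonalized by the unitary `U` with real eigenvalues `p`. -/
def IsDiagonalization (M U : Matrix n n ℂ) (p : n → ℝ) : Prop :=
  Uᴴ * U = 1 ∧ M = U * diagonal (fun i => (p i : ℂ)) * Uᴴ

lemma IsDiagonalization.mul_conjTranspose {M U : Matrix n n ℂ} {p : n → ℝ}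
    (h : IsDiagonalization M U p) : U * Uᴴ = 1 :=
  mul_eq_one_comm.mp h.1

lemma IsDiagonalization.conj_eq {M U : Matrix n n ℂ} {p : n → ℝ}
    (h : IsDiagonalization M U p) : Uᴴ * M * U = diagonal (fun i => (p i : ℂ)) := by
  rw [h.2]
  calc Uᴴ * (U * diagonal (fun i => (p i : ℂ)) * Uᴴ) * U
      = (Uᴴ * U) * diagonal (fun i => (p i : ℂ)) * (Uᴴ * U) := by simp only [Matrix.mul_assoc]
    _ = _ := by rw [h.1]; simp

lemma IsDiagonalization.of_conj {M U : Matrix n n ℂ} {p : n → ℝ} (h1 : Uᴴ * U = 1)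
    (h : Uᴴ * M * U = diagonal (fun i => (p i : ℂ))) : IsDiagonalization M U p := by
  refine ⟨h1, ?_⟩
  have h2 : U * Uᴴ = 1 := mul_eq_one_comm.mp h1
  rw [← h]
  calc M = (U * Uᴴ) * M * (U * Uᴴ) := by rw [h2]; simp
    _ = _ := by simp only [Matrix.mul_assoc]

lemma exists_isDiagonalization {M : Matrix n n ℂ} (hM : M.IsHermitian) :
    IsDiagonalization M (hM.eigenvectorUnitary : Matrix n n ℂ) hM.eigenvalues := by
  refine ⟨Unitary.coe_star_mul_self hM.eigenvectorUnitary, ?_⟩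
  conv_lhs => rw [hM.spectral_theorem, Unitary.conjStarAlgAut_apply]
  rfl

lemma IsDiagonalization.trace {M U : Matrix n n ℂ} {p : n → ℝ}
    (h : IsDiagonalization M U p) : M.trace = ((∑ i, p i : ℝ) : ℂ) := by
  rw [h.2, trace_mul_comm, ← Matrix.mul_assoc, h.1, Matrix.one_mul, trace_diagonal]
  push_cast; rfl

lemma exists_isDiagonalization_of_posSemidef {M : Matrix n n ℂ} (hM : M.PosSemidef) :
    ∃ U p, IsDiagonalization M U p ∧ ∀ i, 0 ≤ p i :=
  ⟨_, _, exists_isDiagonalization hM.1, hM.eigenvalues_nonneg⟩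

lemma IsDiagonalization.charpoly {M U : Matrix n n ℂ} {p : n → ℝ}
    (h : IsDiagonalization M U p) :
    M.charpoly = ∏ i, (Polynomial.X - Polynomial.C (p i : ℂ)) := by
  rw [h.2, charpoly_mul_comm, ← Matrix.mul_assoc, h.1, Matrix.one_mul, charpoly_diagonal]

lemma roots_prod_X_sub_C {ι : Type*} [Fintype ι] (d : ι → ℂ) :
    (∏ i, (Polynomial.X - Polynomial.C (d i))).roots = Multiset.map d Finset.univ.val := by
  rw [Polynomial.roots_prod]
  · simp
  · simp [Finset.prod_ne_zero_iff, Polynomial.X_sub_C_ne_zero]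

lemma IsDiagonalization.natEntropy_eq {M U : Matrix n n ℂ} {p : n → ℝ}
    (h : IsDiagonalization M U p) : natEntropy M = ∑ i, Real.negMulLog (p i) := by
  rw [natEntropy, h.charpoly, roots_prod_X_sub_C, Multiset.map_map]
  rfl

lemma entropy_eq_natEntropy {M : Matrix n n ℂ} (hM : M.IsHermitian) :
    entropy M = natEntropy M / Real.log 2 := by
  rw [entropy, dif_pos hM, (exists_isDiagonalization hM).natEntropy_eq, Finset.sum_div,
    ← Finset.sum_neg_distrib]
  refine Finset.sum_congr rfl fun i _ => ?_
  rw [Real.negMulLog, Real.logb]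
  ring

lemma natEntropy_transpose (M : Matrix n n ℂ) : natEntropy Mᵀ = natEntropy M := by
  rw [natEntropy, charpoly_transpose, natEntropy]

lemma natEntropy_submatrix_equiv (e : m ≃ n) (M : Matrix n n ℂ) :
    natEntropy (M.submatrix e e) = natEntropy M := by
  have := charpoly_reindex e.symm M
  rw [reindex_apply] at this
  rw [natEntropy, natEntropy, ← this]
  rfl

/-- The entropies of `A * B` and `B * A` agree, for rectangular `A` and `B`. -/
lemma natEntropy_mul_comm (A : Matrix m n ℂ) (B : Matrix n m ℂ) :
    natEntropy (A * B) = natEntropy (B * A) := by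
  have h := congrArg (fun q : Polynomial ℂ =>
    (q.roots.map fun z => Real.negMulLog z.re).sum) (charpoly_mul_comm' A B)
  have h0 : ∀ k : ℕ, (Polynomial.X ^ k : Polynomial ℂ) ≠ 0 := fun k =>
    pow_ne_zero _ Polynomial.X_ne_zero
  beta_reduce at h
  -- The two characteristic polynomials agree up to powers of X, whose roots are 0 and contribute
  -- η(0) = 0.
  rw [Polynomial.roots_mul (mul_ne_zero (h0 _) (charpoly_monic _).ne_zero),
    Polynomial.roots_mul (mul_ne_zero (h0 _) (charpoly_monic _).ne_zero)] at h
  simpa [natEntropy, Multiset.map_nsmul, Multiset.sum_nsmul] using h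

/-- The block diagonal matrix with blocks `N z`, the block index being the first component. -/
def blockMat {Z Y : Type*} [DecidableEq Z] (N : Z → Matrix Y Y ℂ) : Matrix (Z × Y) (Z × Y) ℂ :=
  Matrix.of fun i j => if i.1 = j.1 then N i.1 i.2 j.2 else 0

lemma natEntropy_blockMat (N : m → Matrix n n ℂ) :
    natEntropy (blockMat N) = ∑ z, natEntropy (N z) := by
  have h1 : blockMat N = (blockDiagonal N).submatrix (Equiv.prodComm m n) (Equiv.prodComm m n) := by
    ext ⟨z, y⟩ ⟨z', y'⟩
    simp [blockMat, blockDiagonal_apply]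
  rw [h1, natEntropy_submatrix_equiv]
  have h2 : (blockDiagonal N).charpoly = ∏ z, (N z).charpoly := by
    simp only [Matrix.charpoly]
    rw [← det_blockDiagonal]
    congr 1
    ext ⟨y, z⟩ ⟨y', z'⟩ : 2
    by_cases hz : z = z' <;> by_cases hy : y = y' <;>
      simp [blockDiagonal_apply, hz, hy]
  rw [natEntropy, h2, Polynomial.roots_prod _ _
    (Finset.prod_ne_zero_iff.mpr fun z _ => (charpoly_monic _).ne_zero), Multiset.map_bind,
    Multiset.sum_bind]
  rfl

end Spectral

/-! ### Scalar inequalities -/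

/-- Tangent bound for the mixing term `η(x) + η(y) - η(x + y)`. -/
lemma negMulLog_add_negMulLog_le {x y ε : ℝ} (hx : 0 ≤ x) (hy : 0 ≤ y) (hε : 0 < ε) :
    Real.negMulLog x + Real.negMulLog y - Real.negMulLog (x + y) ≤
      x * Real.log (1 + ε) + y * (Real.log (1 + ε) - Real.log ε) := by
  rcases hx.eq_or_lt with rfl | hx
  · have : Real.log ε ≤ Real.log (1 + ε) := Real.log_le_log hε (by linarith)
    simp
    nlinarith
  rcases hy.eq_or_lt with rfl | hy
  · have : 0 ≤ Real.log (1 + ε) := Real.log_nonneg (by linarith)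
    simp
    positivity
  -- Both arguments of the logarithm equal 1 at y = εx, the point of tangency; by `h5` the weighted
  -- errors of log u ≤ u - 1 cancel.
  have h1 : Real.log ((x + y) / (x * (1 + ε))) ≤ (x + y) / (x * (1 + ε)) - 1 :=
    Real.log_le_sub_one_of_pos (by positivity)
  have h2 : Real.log ((x + y) * ε / (y * (1 + ε))) ≤ (x + y) * ε / (y * (1 + ε)) - 1 :=
    Real.log_le_sub_one_of_pos (by positivity)
  rw [Real.log_div (by positivity) (by positivity), Real.log_mul (by positivity) (by positivity)]
    at h1
  rw [Real.log_div (by positivity) (by positivity), Real.log_mul (by positivity) (by positivity),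
    Real.log_mul (by positivity) (by positivity)] at h2
  have h3 := mul_le_mul_of_nonneg_left h1 hx.le
  have h4 := mul_le_mul_of_nonneg_left h2 hy.le
  have h5 : x * ((x + y) / (x * (1 + ε)) - 1) + y * ((x + y) * ε / (y * (1 + ε)) - 1) = 0 := by
    field_simp
    ring
  simp only [Real.negMulLog]
  nlinarith

/-- Jensen's inequality for `η` with uniform weights. -/
lemma sum_negMulLog_le {ι : Type*} [Fintype ι] {m : ι → ℝ} (hm : ∀ i, 0 ≤ m i) :
    ∑ i, Real.negMulLog (m i) ≤
      Real.negMulLog (∑ i, m i) + (∑ i, m i) * Real.log (Fintype.card ι) := by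
  rcases isEmpty_or_nonempty ι with h | h
  · simp
  have hc : (0 : ℝ) < Fintype.card ι := by exact_mod_cast Fintype.card_pos
  have key : ∀ i, Real.negMulLog (m i) ≤
      m i * (Real.log (Fintype.card ι) - Real.log (∑ j, m j))
        + ((∑ j, m j) / Fintype.card ι - m i) := by
    intro i
    rcases (hm i).eq_or_lt with h0 | h0
    · rw [← h0]
      have : 0 ≤ ∑ j, m j := Finset.sum_nonneg fun j _ => hm j
      simp
      positivity
    have hs : 0 < ∑ j, m j :=
      lt_of_lt_of_le h0 (Finset.single_le_sum (fun j _ => hm j) (Finset.mem_univ i))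
    have h1 := Real.log_le_sub_one_of_pos
      (show 0 < (∑ j, m j) / (Fintype.card ι * m i) by positivity)
    rw [Real.log_div hs.ne' (by positivity), Real.log_mul hc.ne' h0.ne'] at h1
    have h2 := mul_le_mul_of_nonneg_left h1 h0.le
    have h3 : m i * ((∑ j, m j) / (Fintype.card ι * m i) - 1)
        = (∑ j, m j) / Fintype.card ι - m i := by
      field_simp
    simp only [Real.negMulLog]
    linarith
  refine (Finset.sum_le_sum fun i _ => key i).trans (le_of_eq ?_)
  rw [Finset.sum_add_distrib, ← Finset.sum_mul, Finset.sum_sub_distrib, Finset.sum_const,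
    Finset.card_univ, nsmul_eq_mul, Real.negMulLog]
  field_simp
  ring

/-! ### Peierls inequality and entropy of sums -/

section Peierls

variable {n : Type*} [Fintype n] [DecidableEq n]

lemma sum_norm_sq_col {W : Matrix n n ℂ} (h : Wᴴ * W = 1) (j : n) : ∑ i, ‖W i j‖ ^ 2 = 1 := by
  have h1 := congrFun (congrFun h j) j
  rw [mul_apply, one_apply_eq] at h1
  have h2 : ((∑ i, ‖W i j‖ ^ 2 : ℝ) : ℂ) = 1 := by
    rw [← h1]
    push_cast
    refine Finset.sum_congr rfl fun i _ => ?_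
    rw [conjTranspose_apply, ← Complex.conj_mul']
    rfl
  exact_mod_cast h2

lemma sum_norm_sq_row {W : Matrix n n ℂ} (h : W * Wᴴ = 1) (i : n) : ∑ j, ‖W i j‖ ^ 2 = 1 := by
  have h1 := sum_norm_sq_col (W := Wᴴ) (by rwa [conjTranspose_conjTranspose]) i
  simpa using h1

/-- Diagonal entries in another basis are averages of the eigenvalues. -/
lemma IsDiagonalization.conj_apply_self {M U : Matrix n n ℂ} {p : n → ℝ}
    (h : IsDiagonalization M U p) (V : Matrix n n ℂ) (j : n) :
    (Vᴴ * M * V) j j = ((∑ i, ‖(Uᴴ * V) i j‖ ^ 2 * p i : ℝ) : ℂ) := by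
  have h1 : Vᴴ * M * V = (Uᴴ * V)ᴴ * diagonal (fun i => (p i : ℂ)) * (Uᴴ * V) := by
    rw [h.2, conjTranspose_mul, conjTranspose_conjTranspose]
    simp only [Matrix.mul_assoc]
  rw [h1, mul_apply]
  push_cast
  refine Finset.sum_congr rfl fun i _ => ?_
  rw [mul_diagonal, conjTranspose_apply, ← Complex.conj_mul']
  simp only [starRingEnd_apply]
  ring

lemma conjTranspose_mul_unitary {U V : Matrix n n ℂ} (hU : U * Uᴴ = 1) (hV : Vᴴ * V = 1) :
    (Uᴴ * V)ᴴ * (Uᴴ * V) = 1 := by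
  rw [conjTranspose_mul, conjTranspose_conjTranspose]
  calc Vᴴ * U * (Uᴴ * V) = Vᴴ * (U * Uᴴ) * V := by simp only [Matrix.mul_assoc]
    _ = 1 := by rw [hU, Matrix.mul_one, hV]

/-- The entropy is at most the entropy of the diagonal in any orthonormal basis. -/
lemma natEntropy_le_sum_diag {M V : Matrix n n ℂ} (hM : M.PosSemidef) (hV : Vᴴ * V = 1) :
    natEntropy M ≤ ∑ j, Real.negMulLog ((Vᴴ * M * V) j j).re := by
  obtain ⟨U, p, h, hp⟩ := exists_isDiagonalization_of_posSemidef hM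
  have hW := conjTranspose_mul_unitary h.mul_conjTranspose hV
  have hW' := mul_eq_one_comm.mp hW
  calc natEntropy M = ∑ i, Real.negMulLog (p i) := h.natEntropy_eq
    _ = ∑ i, (∑ j, ‖(Uᴴ * V) i j‖ ^ 2) * Real.negMulLog (p i) := by
        simp only [sum_norm_sq_row hW', one_mul]
    _ = ∑ j, ∑ i, ‖(Uᴴ * V) i j‖ ^ 2 * Real.negMulLog (p i) := by
        simp only [Finset.sum_mul]
        exact Finset.sum_comm
    _ ≤ ∑ j, Real.negMulLog (∑ i, ‖(Uᴴ * V) i j‖ ^ 2 * p i) := by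
        refine Finset.sum_le_sum fun j _ => ?_
        exact Real.concaveOn_negMulLog.le_map_sum (fun i _ => by positivity)
          (sum_norm_sq_col hW j) (fun i _ => hp i)
    _ = _ := by simp only [h.conj_apply_self, Complex.ofReal_re]

lemma re_conj_apply_self_nonneg {n : Type*} [Fintype n] {M : Matrix n n ℂ} (hM : M.PosSemidef)
    (V : Matrix n n ℂ) (j : n) : 0 ≤ ((Vᴴ * M * V) j j).re :=
  (Complex.le_def.mp ((hM.conjTranspose_mul_mul_same V).diag_nonneg (i := j))).1

lemma trace_conj {M V : Matrix n n ℂ} (hV : Vᴴ * V = 1) : (Vᴴ * M * V).trace = M.trace := by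
  rw [trace_mul_comm, ← Matrix.mul_assoc, mul_eq_one_comm.mp hV, Matrix.one_mul]

lemma sum_re_conj_apply_self {M V : Matrix n n ℂ} (hV : Vᴴ * V = 1) :
    ∑ j, ((Vᴴ * M * V) j j).re = M.trace.re := by
  rw [← trace_conj (M := M) hV, Matrix.trace, Complex.re_sum]
  rfl

/-- In an eigenbasis of `X + Y` the diagonal gives the entropy of the sum exactly and can only
overestimate those of `X` and `Y`, so the scalar tangent bound applies entrywise. -/
lemma natEntropy_add_natEntropy_le {X Y : Matrix n n ℂ} (hX : X.PosSemidef) (hY : Y.PosSemidef)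
    {ε : ℝ} (hε : 0 < ε) :
    natEntropy X + natEntropy Y - natEntropy (X + Y) ≤
      X.trace.re * Real.log (1 + ε) + Y.trace.re * (Real.log (1 + ε) - Real.log ε) := by
  obtain ⟨V, q, h, -⟩ := exists_isDiagonalization_of_posSemidef (hX.add hY)
  have hq : ∀ j, q j = ((Vᴴ * X * V) j j).re + ((Vᴴ * Y * V) j j).re := by
    intro j
    have h1 := congrFun (congrFun h.conj_eq j) j
    rw [diagonal_apply_eq, Matrix.mul_add, Matrix.add_mul, Matrix.add_apply] at h1
    rw [← Complex.add_re, h1, Complex.ofReal_re]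
  have h1 := natEntropy_le_sum_diag hX h.1
  have h2 := natEntropy_le_sum_diag hY h.1
  have h3 := Finset.sum_le_sum fun j (_ : j ∈ Finset.univ) =>
    negMulLog_add_negMulLog_le (re_conj_apply_self_nonneg hX V j)
      (re_conj_apply_self_nonneg hY V j) hε
  rw [h.natEntropy_eq]
  simp only [hq]
  rw [Finset.sum_sub_distrib, Finset.sum_add_distrib, Finset.sum_add_distrib, ← Finset.sum_mul,
    ← Finset.sum_mul, sum_re_conj_apply_self h.1, sum_re_conj_apply_self h.1] at h3
  linarith

/-- A positive semidefinite matrix has a square root factor with orthogonal columns. -/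
lemma IsDiagonalization.exists_factor {M U : Matrix n n ℂ} {p : n → ℝ}
    (h : IsDiagonalization M U p) (hp : ∀ i, 0 ≤ p i) :
    ∃ K : Matrix n n ℂ, M = K * Kᴴ ∧ Kᴴ * K = diagonal (fun i => (p i : ℂ)) := by
  have hs : diagonal (fun i => ((√(p i) : ℝ) : ℂ)) * (diagonal (fun i => ((√(p i) : ℝ) : ℂ)))
      = diagonal (fun i => (p i : ℂ)) := by
    rw [diagonal_mul_diagonal]
    congr 1
    ext i
    rw [← Complex.ofReal_mul, Real.mul_self_sqrt (hp i)]
  have hs' : (diagonal (fun i => ((√(p i) : ℝ) : ℂ)))ᴴ =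
      diagonal (fun i => ((√(p i) : ℝ) : ℂ)) := by
    rw [diagonal_conjTranspose]
    congr 1
    ext i
    rw [Pi.star_apply, Complex.star_def, Complex.conj_ofReal]
  refine ⟨U * diagonal (fun i => ((√(p i) : ℝ) : ℂ)), ?_, ?_⟩
  · rw [conjTranspose_mul, hs', h.2, ← hs]
    simp only [Matrix.mul_assoc]
  · rw [conjTranspose_mul, hs', Matrix.mul_assoc, ← Matrix.mul_assoc Uᴴ, h.1, Matrix.one_mul, hs]

lemma exists_eq_mul_conjTranspose {M : Matrix n n ℂ} (hM : M.PosSemidef) :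
    ∃ K : Matrix n n ℂ, M = K * Kᴴ := by
  obtain ⟨U, p, h, hp⟩ := exists_isDiagonalization_of_posSemidef hM
  obtain ⟨K, hK, -⟩ := h.exists_factor hp
  exact ⟨K, hK⟩

/-- With X = KKᴴ and Y = LLᴴ, the sum has the same entropy as the Gram matrix of [K L]. The factors
have orthogonal columns, so the diagonal of that matrix consists of the eigenvalues of `X` and `Y`,
and Peierls applies. -/
lemma natEntropy_add_le {X Y : Matrix n n ℂ} (hX : X.PosSemidef) (hY : Y.PosSemidef) :
    natEntropy (X + Y) ≤ natEntropy X + natEntropy Y := by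
  obtain ⟨U, p, hU, hp⟩ := exists_isDiagonalization_of_posSemidef hX
  obtain ⟨V, q, hV, hq⟩ := exists_isDiagonalization_of_posSemidef hY
  obtain ⟨K, hK, hK'⟩ := hU.exists_factor hp
  obtain ⟨L, hL, hL'⟩ := hV.exists_factor hq
  have h1 : X + Y = fromCols K L * (fromCols K L)ᴴ := by
    rw [conjTranspose_fromCols_eq_fromRows_conjTranspose, fromCols_mul_fromRows, hK, hL]
  have h2 : (fromCols K L)ᴴ * fromCols K L =
      fromBlocks (diagonal (fun i => (p i : ℂ))) (Kᴴ * L) (Lᴴ * K)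
        (diagonal (fun i => (q i : ℂ))) := by
    rw [conjTranspose_fromCols_eq_fromRows_conjTranspose, fromRows_mul_fromCols, hK', hL']
  rw [h1, natEntropy_mul_comm]
  refine (natEntropy_le_sum_diag (V := 1) (posSemidef_conjTranspose_mul_self _) (by simp)).trans ?_
  rw [h2, hU.natEntropy_eq, hV.natEntropy_eq, Fintype.sum_sum_type]
  simp

end Peierls

/-! ### Conditional entropy and its dimension bounds -/

section ConditionalEntropy

variable {A B : Type*} [Fintype A] [Fintype B]

lemma trace_traceLast (M : Matrix (B × A) (B × A) ℂ) : (traceLast M).trace = M.trace := by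
  simp only [Matrix.trace, traceLast, diag_apply, of_apply, Fintype.sum_prod_type]

lemma traceLast_add {B : Type*} (M N : Matrix (B × A) (B × A) ℂ) :
    traceLast (M + N) = traceLast M + traceLast N := by
  ext i j
  simp [traceLast, Finset.sum_add_distrib]

lemma posSemidef_traceLast {B : Type*} {M : Matrix (B × A) (B × A) ℂ} (hM : M.PosSemidef) :
    (traceLast M).PosSemidef := by
  have h : traceLast M = ∑ a, M.submatrix (fun b => (b, a)) (fun b => (b, a)) := by
    ext i j
    simp [traceLast, Matrix.sum_apply]
  rw [h]
  exact posSemidef_sum _ fun a _ => hM.submatrix _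

variable [DecidableEq A]

lemma conj_kronecker_one (M : Matrix (B × A) (B × A) ℂ) (V : Matrix B B ℂ) (b b' : B) :
    ∑ a, ((V.kronecker (1 : Matrix A A ℂ))ᴴ * M * V.kronecker (1 : Matrix A A ℂ)) (b, a) (b', a) =
      (Vᴴ * traceLast M * V) b b' := by
  simp only [kronecker, mul_apply, conjTranspose_apply, kroneckerMap_apply, one_apply,
    Fintype.sum_prod_type, traceLast, of_apply, Finset.sum_mul, Finset.mul_sum, mul_ite, mul_one,
    mul_zero, apply_ite star, star_zero, ite_mul, zero_mul, Finset.sum_ite_eq', Finset.mem_univ,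
    if_true]
  rw [Finset.sum_comm]
  refine Finset.sum_congr rfl fun c _ => ?_
  rw [Finset.sum_comm]

variable [DecidableEq B]

lemma kronecker_one_unitary {V : Matrix B B ℂ} (hV : Vᴴ * V = 1) :
    (V.kronecker (1 : Matrix A A ℂ))ᴴ * V.kronecker (1 : Matrix A A ℂ) = 1 := by
  rw [kronecker, conjTranspose_kronecker, ← mul_kronecker_mul, hV]
  simp

/-- The conditional entropy `S(A|B)` in nats of an operator on `BA`. -/
def condEntropy (M : Matrix (B × A) (B × A) ℂ) : ℝ :=
  natEntropy M - natEntropy (traceLast M)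

/-- In the product basis built from an eigenbasis of the marginal, the diagonal entries over each b
sum to the eigenvalue `q b`; Jensen over `A` then costs at most log |A| per unit of mass. -/
lemma condEntropy_le {M : Matrix (B × A) (B × A) ℂ} (hM : M.PosSemidef) :
    condEntropy M ≤ M.trace.re * Real.log (Fintype.card A) := by
  obtain ⟨V, q, h, -⟩ := exists_isDiagonalization_of_posSemidef (posSemidef_traceLast hM)
  have hV := kronecker_one_unitary (A := A) h.1
  have h1 := natEntropy_le_sum_diag hM hV
  have hq : ∀ b, ∑ a, (((V.kronecker (1 : Matrix A A ℂ))ᴴ * M *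
      V.kronecker (1 : Matrix A A ℂ)) (b, a) (b, a)).re = q b := by
    intro b
    rw [← Complex.re_sum, conj_kronecker_one, h.conj_eq, diagonal_apply_eq, Complex.ofReal_re]
  have h2 : ∑ b, q b = M.trace.re := by
    rw [← trace_traceLast, h.trace, Complex.ofReal_re]
  rw [Fintype.sum_prod_type] at h1
  have h3 := Finset.sum_le_sum fun b (_ : b ∈ Finset.univ) =>
    sum_negMulLog_le (fun a => re_conj_apply_self_nonneg hM (V.kronecker (1 : Matrix A A ℂ)) (b, a))
  simp only [hq] at h3
  rw [Finset.sum_add_distrib, ← Finset.sum_mul, h2, ← h.natEntropy_eq] at h3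
  rw [condEntropy]
  linarith

/-- Duality: the factor `K` is a purification of `M` by its column index E, and S(A|E) = -S(A|B), so
the upper bound for S(A|E) is the lower bound here. `Ψ` is the same tensor cut as B against EA. -/
lemma neg_le_condEntropy {M : Matrix (B × A) (B × A) ℂ} (hM : M.PosSemidef) :
    -(M.trace.re * Real.log (Fintype.card A)) ≤ condEntropy M := by
  obtain ⟨K, rfl⟩ := exists_eq_mul_conjTranspose hM
  set Ψ : Matrix B ((B × A) × A) ℂ := of fun b i => K (b, i.2) i.1 with hΨ
  have h1 : traceLast (K * Kᴴ) = Ψ * Ψᴴ := by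
    ext b b'
    simp only [traceLast, of_apply, mul_apply, hΨ, conjTranspose_apply,
      Fintype.sum_prod_type_right]
  have h2 : traceLast (Ψᴴ * Ψ) = Kᴴ * K := by
    ext e e'
    simp only [traceLast, of_apply, mul_apply, hΨ, conjTranspose_apply,
      Fintype.sum_prod_type_right]
  have h3 := condEntropy_le (posSemidef_conjTranspose_mul_self Ψ)
  rw [condEntropy, h2, ← trace_traceLast, h2, ← natEntropy_mul_comm Ψ, ← h1,
    trace_mul_comm Kᴴ, natEntropy_mul_comm Kᴴ] at h3
  rw [condEntropy]
  linarith

end ConditionalEntropy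

/-! ### Joint convexity of the relative entropy -/

lemma convexCombo_pos {s x y : ℝ} (hs : s ∈ Set.Icc (0 : ℝ) 1) (hx : 0 < x) (hy : 0 < y) :
    0 < (1 - s) * x + s * y := by
  rcases hs.1.eq_or_lt with rfl | h
  · simpa using hx
  · have := mul_pos h hy
    have := mul_nonneg (sub_nonneg.mpr hs.2) hx.le
    linarith

/-- Taylor's formula with integral remainder for x log x, expanded at q and evaluated at p; the
second derivative is 1/x. -/
lemma integral_relEntropy_kernel {p q : ℝ} (hp : 0 < p) (hq : 0 < q) :
    ∫ s in (0 : ℝ)..1, s * ((p - q) ^ 2 / ((1 - s) * p + s * q)) =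
      p * (Real.log p - Real.log q) - p + q := by
  have hd : ∀ s ∈ Set.uIcc (0 : ℝ) 1, 0 < (1 - s) * p + s * q := by
    rw [Set.uIcc_of_le zero_le_one]
    exact fun s hs => convexCombo_pos hs hp hq
  have hder : ∀ s ∈ Set.uIcc (0 : ℝ) 1,
      HasDerivAt (fun s => (q - p) * s - p * Real.log ((1 - s) * p + s * q))
        (s * ((p - q) ^ 2 / ((1 - s) * p + s * q))) s := by
    intro s hs
    have h := hd s hs
    have h1 : HasDerivAt (fun s : ℝ => (1 - s) * p + s * q) (-1 * p + 1 * q) s :=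
      (((hasDerivAt_id s).const_sub 1).mul_const p).add ((hasDerivAt_id s).mul_const q)
    have h2 := ((hasDerivAt_id s).const_mul (q - p)).sub ((h1.log h.ne').const_mul p)
    refine h2.congr_deriv ?_
    generalize hd : (1 - s) * p + s * q = d at h
    field_simp
    rw [← hd]
    ring
  rw [intervalIntegral.integral_eq_sub_of_hasDerivAt hder]
  · simp
    ring
  · apply ContinuousOn.intervalIntegrable
    exact continuousOn_id.mul (continuousOn_const.div (by fun_prop) fun s hs => (hd s hs).ne')

/-! ### Variational formula for the resolvent form -/

section Variational

variable {n : Type*} [Fintype n] [DecidableEq n]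

/-- The functional, linear in `(M, N)`, whose supremum over `Y` is `resolventForm`. -/
def variationalForm (s : ℝ) (M N Y : Matrix n n ℂ) : ℝ :=
  2 * (Yᴴ * (M - N)).trace.re - (1 - s) * (Yᴴ * M * Y).trace.re - s * (Y * N * Yᴴ).trace.re

omit [DecidableEq n] in
lemma variationalForm_add (s : ℝ) (M N M' N' Y : Matrix n n ℂ) :
    variationalForm s (M + M') (N + N') Y =
      variationalForm s M N Y + variationalForm s M' N' Y := by
  simp only [variationalForm, Matrix.mul_add, Matrix.add_mul, Matrix.mul_sub, trace_add, trace_sub,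
    Complex.add_re, Complex.sub_re]
  ring

/-- The quadratic form `⟨M - N, ((1 - s) L_M + s R_N)⁻¹ (M - N)⟩` in terms of diagonalizations of
`M` and `N`. -/
def resolventForm (s : ℝ) (U : Matrix n n ℂ) (p : n → ℝ) (V : Matrix n n ℂ) (q : n → ℝ) : ℝ :=
  ∑ i, ∑ j, ‖(Uᴴ * V) i j‖ ^ 2 * ((p i - q j) ^ 2 / ((1 - s) * p i + s * q j))

/-- In the two eigenbases, left multiplication by `M` and right multiplication by `N` are
simultaneously diagonal, so the functional splits into independent scalar problems in the entries of
`Z`. -/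
lemma variationalForm_eq {M N U V : Matrix n n ℂ} {p q : n → ℝ} (hM : IsDiagonalization M U p)
    (hN : IsDiagonalization N V q) (s : ℝ) (Z : Matrix n n ℂ) :
    variationalForm s M N (U * Z * Vᴴ) = ∑ i, ∑ j,
      (2 * ((star (Z i j) * (Uᴴ * V) i j).re * (p i - q j))
        - ‖Z i j‖ ^ 2 * ((1 - s) * p i + s * q j)) := by
  set P := diagonal (fun i => (p i : ℂ)) with hP
  set Q := diagonal (fun i => (q i : ℂ)) with hQ
  have e1 : ((U * Z * Vᴴ)ᴴ * (M - N)).trace = (Zᴴ * (P * (Uᴴ * V) - Uᴴ * V * Q)).trace := by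
    have h1 : (U * Z * Vᴴ)ᴴ * (M - N) = V * (Zᴴ * Uᴴ * (M - N)) := by
      simp only [conjTranspose_mul, conjTranspose_conjTranspose, Matrix.mul_assoc]
    have h2 : Uᴴ * M = P * Uᴴ := by
      rw [hM.2, ← Matrix.mul_assoc, ← Matrix.mul_assoc, hM.1, Matrix.one_mul]
    have h3 : N * V = V * Q := by
      rw [hN.2, Matrix.mul_assoc, hN.1, Matrix.mul_one]
    rw [h1, trace_mul_comm]
    congr 1
    calc Zᴴ * Uᴴ * (M - N) * V = Zᴴ * (Uᴴ * M * V - Uᴴ * (N * V)) := by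
          simp only [Matrix.mul_sub, Matrix.sub_mul, Matrix.mul_assoc]
      _ = _ := by rw [h2, h3]; simp only [Matrix.mul_assoc]
  have e2 : ((U * Z * Vᴴ)ᴴ * M * (U * Z * Vᴴ)).trace = (Zᴴ * P * Z).trace := by
    have h1 : (U * Z * Vᴴ)ᴴ * M * (U * Z * Vᴴ) = V * (Zᴴ * (Uᴴ * M * U) * Z * Vᴴ) := by
      simp only [conjTranspose_mul, conjTranspose_conjTranspose, Matrix.mul_assoc]
    rw [h1, trace_mul_comm, hM.conj_eq, Matrix.mul_assoc _ Vᴴ, hN.1, Matrix.mul_one]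
  have e3 : ((U * Z * Vᴴ) * N * (U * Z * Vᴴ)ᴴ).trace = (Z * Q * Zᴴ).trace := by
    have h1 : (U * Z * Vᴴ) * N * (U * Z * Vᴴ)ᴴ = U * (Z * (Vᴴ * N * V) * Zᴴ * Uᴴ) := by
      simp only [conjTranspose_mul, conjTranspose_conjTranspose, Matrix.mul_assoc]
    rw [h1, trace_mul_comm, hN.conj_eq, Matrix.mul_assoc _ Uᴴ, hM.1, Matrix.mul_one]
  have f1 : (Zᴴ * (P * (Uᴴ * V) - Uᴴ * V * Q)).trace.re =
      ∑ i, ∑ j, (star (Z i j) * (Uᴴ * V) i j).re * (p i - q j) := by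
    rw [Finset.sum_comm, Matrix.trace, Complex.re_sum]
    refine Finset.sum_congr rfl fun j _ => ?_
    rw [diag_apply, mul_apply, Complex.re_sum]
    refine Finset.sum_congr rfl fun i _ => ?_
    rw [Matrix.sub_apply, hP, hQ, diagonal_mul, mul_diagonal, conjTranspose_apply,
      ← Complex.re_mul_ofReal]
    congr 1
    push_cast
    ring
  have f2 : (Zᴴ * P * Z).trace.re = ∑ i, ∑ j, ‖Z i j‖ ^ 2 * p i := by
    rw [Finset.sum_comm, Matrix.trace, Complex.re_sum]
    refine Finset.sum_congr rfl fun j _ => ?_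
    rw [diag_apply, mul_apply, Complex.re_sum]
    refine Finset.sum_congr rfl fun i _ => ?_
    rw [hP, mul_diagonal, conjTranspose_apply, ← Complex.ofReal_re (‖Z i j‖ ^ 2 * p i)]
    congr 1
    push_cast
    rw [← Complex.conj_mul', starRingEnd_apply]
    ring
  have f3 : (Z * Q * Zᴴ).trace.re = ∑ i, ∑ j, ‖Z i j‖ ^ 2 * q j := by
    rw [Matrix.trace, Complex.re_sum]
    refine Finset.sum_congr rfl fun j _ => ?_
    rw [diag_apply, mul_apply, Complex.re_sum]
    refine Finset.sum_congr rfl fun i _ => ?_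
    rw [hQ, mul_diagonal, conjTranspose_apply, ← Complex.ofReal_re (‖Z j i‖ ^ 2 * q i)]
    congr 1
    push_cast
    rw [← Complex.conj_mul', starRingEnd_apply]
    ring
  rw [variationalForm, e1, e2, e3, f1, f2, f3]
  simp only [Finset.mul_sum, ← Finset.sum_sub_distrib]
  refine Finset.sum_congr rfl fun i _ => Finset.sum_congr rfl fun j _ => ?_
  ring

/-- Completing the square; the maximum is at z = wc/d, which gives the maximizer in
`exists_variationalForm_eq`. -/
lemma two_mul_re_sub_le {d : ℝ} (hd : 0 < d) (z w : ℂ) (c : ℝ) :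
    2 * ((star z * w).re * c) - ‖z‖ ^ 2 * d ≤ ‖w‖ ^ 2 * (c ^ 2 / d) := by
  have h : 0 ≤ ‖z * d - w * c‖ ^ 2 / d := by positivity
  have h1 : ‖z * d - w * c‖ ^ 2 / d =
      ‖w‖ ^ 2 * (c ^ 2 / d) - (2 * ((star z * w).re * c) - ‖z‖ ^ 2 * d) := by
    rw [← Complex.normSq_eq_norm_sq, ← Complex.normSq_eq_norm_sq, ← Complex.normSq_eq_norm_sq]
    simp only [Complex.normSq_apply, Complex.sub_re, Complex.sub_im, Complex.mul_re,
      Complex.mul_im, Complex.ofReal_re, Complex.ofReal_im, Complex.star_def, Complex.conj_re,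
      Complex.conj_im]
    field_simp
    ring
  linarith

lemma variationalForm_le {M N U V : Matrix n n ℂ} {p q : n → ℝ} (hM : IsDiagonalization M U p)
    (hN : IsDiagonalization N V q) {s : ℝ} (hd : ∀ i j, 0 < (1 - s) * p i + s * q j)
    (Y : Matrix n n ℂ) : variationalForm s M N Y ≤ resolventForm s U p V q := by
  have hY : Y = U * (Uᴴ * Y * V) * Vᴴ := by
    calc Y = (U * Uᴴ) * Y * (V * Vᴴ) := by
          rw [hM.mul_conjTranspose, hN.mul_conjTranspose, Matrix.one_mul, Matrix.mul_one]
      _ = _ := by simp only [Matrix.mul_assoc]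
  rw [hY, variationalForm_eq hM hN, resolventForm]
  exact Finset.sum_le_sum fun i _ => Finset.sum_le_sum fun j _ => two_mul_re_sub_le (hd i j) _ _ _

lemma exists_variationalForm_eq {M N U V : Matrix n n ℂ} {p q : n → ℝ}
    (hM : IsDiagonalization M U p) (hN : IsDiagonalization N V q) {s : ℝ}
    (hd : ∀ i j, 0 < (1 - s) * p i + s * q j) :
    ∃ Y, variationalForm s M N Y = resolventForm s U p V q := by
  refine ⟨U * (of fun i j => (Uᴴ * V) i j *
    (((p i - q j) / ((1 - s) * p i + s * q j) : ℝ) : ℂ)) * Vᴴ, ?_⟩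
  rw [variationalForm_eq hM hN, resolventForm]
  refine Finset.sum_congr rfl fun i _ => Finset.sum_congr rfl fun j _ => ?_
  have h := hd i j
  rw [of_apply, ← Complex.normSq_eq_norm_sq, ← Complex.normSq_eq_norm_sq]
  generalize (Uᴴ * V) i j = w
  generalize (1 - s) * p i + s * q j = d at h
  simp only [Complex.normSq_apply, Complex.mul_re,
    Complex.mul_im, Complex.ofReal_re, Complex.ofReal_im, Complex.star_def, Complex.conj_re,
    Complex.conj_im]
  field_simp
  ring

/-- The relative entropy in terms of diagonalizations of the two operators. -/
def relEntropy (U : Matrix n n ℂ) (p : n → ℝ) (V : Matrix n n ℂ) (q : n → ℝ) : ℝ :=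
  ∑ i, ∑ j, ‖(Uᴴ * V) i j‖ ^ 2 * (p i * (Real.log (p i) - Real.log (q j)))

omit [DecidableEq n] in
lemma continuousOn_resolventForm (U V : Matrix n n ℂ) {p q : n → ℝ} (hp : ∀ i, 0 < p i)
    (hq : ∀ i, 0 < q i) :
    ContinuousOn (fun s => s * resolventForm s U p V q) (Set.uIcc (0 : ℝ) 1) := by
  rw [Set.uIcc_of_le zero_le_one]
  refine continuousOn_id.mul (continuousOn_finsetSum _ fun i _ => continuousOn_finsetSum _
    fun j _ => continuousOn_const.mul (continuousOn_const.div (by fun_prop) fun s hs => ?_))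
  exact (convexCombo_pos hs (hp i) (hq j)).ne'

lemma relEntropy_eq_integral {U V : Matrix n n ℂ} {p q : n → ℝ} (hU : Uᴴ * U = 1)
    (hV : Vᴴ * V = 1) (hp : ∀ i, 0 < p i) (hq : ∀ i, 0 < q i) :
    relEntropy U p V q =
      ∑ i, p i - ∑ i, q i + ∫ s in (0 : ℝ)..1, s * resolventForm s U p V q := by
  have hW := conjTranspose_mul_unitary (mul_eq_one_comm.mp hU) hV
  have hW' := mul_eq_one_comm.mp hW
  have h1 : ∫ s in (0 : ℝ)..1, s * resolventForm s U p V q =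
      ∑ i, ∑ j, ‖(Uᴴ * V) i j‖ ^ 2 * (p i * (Real.log (p i) - Real.log (q j)) - p i + q j) := by
    have hcont : ∀ i j, ContinuousOn (fun s : ℝ => ‖(Uᴴ * V) i j‖ ^ 2 *
        (s * ((p i - q j) ^ 2 / ((1 - s) * p i + s * q j)))) (Set.uIcc 0 1) := by
      intro i j
      rw [Set.uIcc_of_le zero_le_one]
      exact continuousOn_const.mul (continuousOn_id.mul (continuousOn_const.div (by fun_prop)
        fun s hs => (convexCombo_pos hs (hp i) (hq j)).ne'))
    simp only [← integral_relEntropy_kernel (hp _) (hq _), ← intervalIntegral.integral_const_mul]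
    simp only [← intervalIntegral.integral_finsetSum fun j _ => (hcont _ j).intervalIntegrable]
    rw [← intervalIntegral.integral_finsetSum]
    · congr 1
      ext s
      rw [resolventForm, Finset.mul_sum]
      refine Finset.sum_congr rfl fun i _ => ?_
      rw [Finset.mul_sum]
      refine Finset.sum_congr rfl fun j _ => ?_
      ring
    · intro i _
      exact (continuousOn_finsetSum _ fun j _ => hcont i j).intervalIntegrable
  have h2 : ∑ i, ∑ j, ‖(Uᴴ * V) i j‖ ^ 2 * p i = ∑ i, p i := by
    refine Finset.sum_congr rfl fun i _ => ?_
    rw [← Finset.sum_mul, sum_norm_sq_row hW', one_mul]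
  have h3 : ∑ i, ∑ j, ‖(Uᴴ * V) i j‖ ^ 2 * q j = ∑ i, q i := by
    rw [Finset.sum_comm]
    refine Finset.sum_congr rfl fun j _ => ?_
    rw [← Finset.sum_mul, sum_norm_sq_col hW, one_mul]
  rw [h1, ← h2, ← h3, relEntropy]
  simp only [← Finset.sum_add_distrib, ← Finset.sum_sub_distrib]
  refine Finset.sum_congr rfl fun i _ => Finset.sum_congr rfl fun j _ => ?_
  ring

/-- Joint subadditivity (equivalently, joint convexity) of the relative entropy. -/
lemma relEntropy_add_le {M N M' N' U V U' V' U'' V'' : Matrix n n ℂ} {p q p' q' p'' q'' : n → ℝ}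
    (hM : IsDiagonalization M U p) (hN : IsDiagonalization N V q)
    (hM' : IsDiagonalization M' U' p') (hN' : IsDiagonalization N' V' q')
    (hM'' : IsDiagonalization (M + M') U'' p'') (hN'' : IsDiagonalization (N + N') V'' q'')
    (hp : ∀ i, 0 < p i) (hq : ∀ i, 0 < q i) (hp' : ∀ i, 0 < p' i) (hq' : ∀ i, 0 < q' i)
    (hp'' : ∀ i, 0 < p'' i) (hq'' : ∀ i, 0 < q'' i) :
    relEntropy U'' p'' V'' q'' ≤ relEntropy U p V q + relEntropy U' p' V' q' := by
  have tr : ∀ {X Y W W' W'' : Matrix n n ℂ} {x y z : n → ℝ}, IsDiagonalization X W x →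
      IsDiagonalization Y W' y → IsDiagonalization (X + Y) W'' z →
      ∑ i, z i = ∑ i, x i + ∑ i, y i := by
    intro X Y W W' W'' x y z hx hy hz
    have := hz.trace
    rw [trace_add, hx.trace, hy.trace] at this
    exact_mod_cast this.symm
  rw [relEntropy_eq_integral hM.1 hN.1 hp hq, relEntropy_eq_integral hM'.1 hN'.1 hp' hq',
    relEntropy_eq_integral hM''.1 hN''.1 hp'' hq'', tr hM hM' hM'', tr hN hN' hN'']
  have i1 := (continuousOn_resolventForm U V hp hq).intervalIntegrable
    (μ := MeasureTheory.volume)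
  have i2 := (continuousOn_resolventForm U' V' hp' hq').intervalIntegrable
    (μ := MeasureTheory.volume)
  have i3 := (continuousOn_resolventForm U'' V'' hp'' hq'').intervalIntegrable
    (μ := MeasureTheory.volume)
  have key := intervalIntegral.integral_mono_on zero_le_one i3 (i1.add i2) (by
    intro s hs
    -- The optimal `Y` for the sum is merely admissible for each summand.
    obtain ⟨Y, hY⟩ := exists_variationalForm_eq hM'' hN''
      fun i j => convexCombo_pos hs (hp'' i) (hq'' j)
    rw [← hY, variationalForm_add, ← mul_add]
    exact mul_le_mul_of_nonneg_left (add_le_add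
      (variationalForm_le hM hN (fun i j => convexCombo_pos hs (hp i) (hq j)) Y)
      (variationalForm_le hM' hN' (fun i j => convexCombo_pos hs (hp' i) (hq' j)) Y)) hs.1)
  rw [intervalIntegral.integral_add i1 i2] at key
  linarith

end Variational

/-! ### Strong subadditivity -/

section StrongSubadditivity

variable {A B : Type*} [Fintype A] [DecidableEq A] [Fintype B] [DecidableEq B]

lemma IsDiagonalization.kronecker_one {N V : Matrix B B ℂ} {q : B → ℝ}
    (h : IsDiagonalization N V q) :
    IsDiagonalization (N.kronecker (1 : Matrix A A ℂ)) (V.kronecker (1 : Matrix A A ℂ))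
      (fun i => q i.1) := by
  refine ⟨kronecker_one_unitary h.1, ?_⟩
  have h1 : diagonal (fun i : B × A => (q i.1 : ℂ)) =
      (diagonal (fun i => (q i : ℂ))).kronecker (1 : Matrix A A ℂ) := by
    rw [← diagonal_one, kronecker, diagonal_kronecker_diagonal]
    simp
  rw [h1]
  conv_lhs => rw [h.2]
  simp only [kronecker, conjTranspose_kronecker, ← mul_kronecker_mul]
  simp

/-- The cross term tr M log(M_B ⊗ 1) sees only the marginal of `M`, hence equals tr M_B log M_B. -/
lemma condEntropy_eq_neg_relEntropy {M U : Matrix (B × A) (B × A) ℂ} {V : Matrix B B ℂ}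
    {p : B × A → ℝ} {q : B → ℝ} (hM : IsDiagonalization M U p)
    (hV : IsDiagonalization (traceLast M) V q) :
    condEntropy M =
      -relEntropy U p (V.kronecker (1 : Matrix A A ℂ)) (fun i => q i.1) := by
  set K := V.kronecker (1 : Matrix A A ℂ) with hK
  have hW' := mul_eq_one_comm.mp (conjTranspose_mul_unitary hM.mul_conjTranspose
    (kronecker_one_unitary (A := A) hV.1))
  have h1 : ∑ i, ∑ j, ‖(Uᴴ * K) i j‖ ^ 2 * (p i * Real.log (p i)) = ∑ i, p i * Real.log (p i) := by
    refine Finset.sum_congr rfl fun i _ => ?_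
    rw [← Finset.sum_mul, sum_norm_sq_row hW', one_mul]
  have hq : ∀ b, ∑ a, ∑ i, ‖(Uᴴ * K) i (b, a)‖ ^ 2 * p i = q b := by
    intro b
    have h := conj_kronecker_one M V b b
    rw [hV.conj_eq, diagonal_apply_eq, ← hK] at h
    simp only [hM.conj_apply_self] at h
    exact_mod_cast h
  have h2 : ∑ i, ∑ j : B × A, ‖(Uᴴ * K) i j‖ ^ 2 * (p i * Real.log (q j.1)) =
      ∑ b, q b * Real.log (q b) := by
    rw [Finset.sum_comm, Fintype.sum_prod_type]
    refine Finset.sum_congr rfl fun b _ => ?_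
    conv_rhs => rw [← hq b]
    rw [Finset.sum_mul]
    refine Finset.sum_congr rfl fun a _ => ?_
    rw [Finset.sum_mul, hq b]
    refine Finset.sum_congr rfl fun i _ => ?_
    ring
  have h3 : relEntropy U p K (fun i => q i.1) =
      ∑ i, ∑ j, ‖(Uᴴ * K) i j‖ ^ 2 * (p i * Real.log (p i)) -
        ∑ i, ∑ j : B × A, ‖(Uᴴ * K) i j‖ ^ 2 * (p i * Real.log (q j.1)) := by
    rw [relEntropy]
    simp only [← Finset.sum_sub_distrib]
    refine Finset.sum_congr rfl fun i _ => Finset.sum_congr rfl fun j _ => ?_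
    ring
  rw [h3, h1, h2, condEntropy, hM.natEntropy_eq, hV.natEntropy_eq]
  simp only [Real.negMulLog, neg_mul, Finset.sum_neg_distrib]
  ring

lemma IsDiagonalization.add_smul_one {n : Type*} [Fintype n] [DecidableEq n] {M U : Matrix n n ℂ}
    {p : n → ℝ} (h : IsDiagonalization M U p) (t : ℝ) :
    IsDiagonalization (M + (t : ℂ) • 1) U (fun i => p i + t) := by
  refine IsDiagonalization.of_conj h.1 ?_
  rw [Matrix.mul_add, Matrix.add_mul, h.conj_eq, Matrix.mul_smul, Matrix.smul_mul, Matrix.mul_one,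
    h.1, smul_one_eq_diagonal, diagonal_add]
  push_cast
  rfl

lemma traceLast_smul_one {B : Type*} [DecidableEq B] (t : ℝ) :
    traceLast ((t : ℂ) • (1 : Matrix (B × A) (B × A) ℂ)) =
    ((Fintype.card A * t : ℝ) : ℂ) • 1 := by
  ext b b'
  by_cases h : b = b' <;> simp [traceLast, one_apply, h]

lemma continuous_condEntropy_add_smul_one {M : Matrix (B × A) (B × A) ℂ} (hM : M.PosSemidef) :
    Continuous fun t : ℝ => condEntropy (M + (t : ℂ) • 1) := by
  have h1 := exists_isDiagonalization hM.1
  have h2 := exists_isDiagonalization (posSemidef_traceLast hM).1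
  simp only [condEntropy, traceLast_add, traceLast_smul_one, (h1.add_smul_one _).natEntropy_eq,
    (h2.add_smul_one _).natEntropy_eq]
  exact (continuous_finsetSum _ fun i _ => Real.continuous_negMulLog.comp (by fun_prop)).sub
    (continuous_finsetSum _ fun i _ => Real.continuous_negMulLog.comp (by fun_prop))

/-- Concavity of the conditional entropy, in homogeneous form. -/
lemma condEntropy_add_le {M N : Matrix (B × A) (B × A) ℂ} (hM : M.PosSemidef)
    (hN : N.PosSemidef) : condEntropy M + condEntropy N ≤ condEntropy (M + N) := by
  rcases isEmpty_or_nonempty A with hA | hA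
  -- For empty `A` the shift |A|t of the marginal below would vanish, so this case is split off.
  · have h : ∀ X : Matrix (B × A) (B × A) ℂ, X = 0 := fun X => Subsingleton.elim _ _
    have h0 : ∀ X : Matrix (B × A) (B × A) ℂ, X.PosSemidef → condEntropy X = 0 := by
      intro X hX
      have h1 := condEntropy_le hX
      have h2 := neg_le_condEntropy hX
      simp [h X] at h1 h2 ⊢
      linarith
    rw [h0 M hM, h0 N hN, h0 _ (hM.add hN), add_zero]
  have hc : (0 : ℝ) < Fintype.card A := by exact_mod_cast Fintype.card_pos
  -- Shifting by t makes all eigenvalues strictly positive, as the integral formula requires; the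
  -- limit t → 0 follows by continuity.
  have key : ∀ t : ℝ, 0 < t → condEntropy (M + (t : ℂ) • 1) + condEntropy (N + (t : ℂ) • 1) ≤
      condEntropy (M + N + ((2 * t : ℝ) : ℂ) • 1) := by
    intro t ht
    have diag : ∀ {X : Matrix (B × A) (B × A) ℂ}, X.PosSemidef → ∀ t : ℝ, 0 < t →
        ∃ U p V q, IsDiagonalization (X + (t : ℂ) • 1) U p ∧
          IsDiagonalization (traceLast (X + (t : ℂ) • 1)) V q ∧ (∀ i, 0 < p i) ∧
          ∀ i, 0 < q i := by
      intro X hX t ht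
      obtain ⟨U, p, hU, hp⟩ := exists_isDiagonalization_of_posSemidef hX
      obtain ⟨V, q, hV, hq⟩ := exists_isDiagonalization_of_posSemidef (posSemidef_traceLast hX)
      refine ⟨U, _, V, _, hU.add_smul_one t, ?_, fun i => add_pos_of_nonneg_of_pos (hp i) ht,
        fun i => add_pos_of_nonneg_of_pos (hq i) (mul_pos hc ht)⟩
      rw [traceLast_add, traceLast_smul_one]
      exact hV.add_smul_one _
    obtain ⟨U, p, V, q, hU, hV, hp, hq⟩ := diag hM t ht
    obtain ⟨U', p', V', q', hU', hV', hp', hq'⟩ := diag hN t ht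
    obtain ⟨U'', p'', V'', q'', hU'', hV'', hp'', hq''⟩ :=
      diag (hM.add hN) (2 * t) (by positivity)
    have e : M + N + ((2 * t : ℝ) : ℂ) • (1 : Matrix (B × A) (B × A) ℂ) =
        (M + (t : ℂ) • 1) + (N + (t : ℂ) • 1) := by
      push_cast
      rw [two_mul, add_smul]
      abel
    rw [condEntropy_eq_neg_relEntropy hU hV, condEntropy_eq_neg_relEntropy hU' hV',
      condEntropy_eq_neg_relEntropy hU'' hV'']
    rw [e] at hU'' hV''
    rw [traceLast_add] at hV''
    have hk : IsDiagonalization ((traceLast (M + (t : ℂ) • 1)).kronecker (1 : Matrix A A ℂ) +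
        (traceLast (N + (t : ℂ) • 1)).kronecker 1) (V''.kronecker 1) (fun i => q'' i.1) := by
      simpa only [kronecker, add_kronecker] using hV''.kronecker_one (A := A)
    have := relEntropy_add_le hU (hV.kronecker_one (A := A)) hU' (hV'.kronecker_one (A := A)) hU''
      hk hp (fun i => hq i.1) hp' (fun i => hq' i.1) hp'' (fun i => hq'' i.1)
    linarith
  have l1 : Filter.Tendsto (fun t : ℝ => condEntropy (M + (t : ℂ) • 1) +
      condEntropy (N + (t : ℂ) • 1)) (nhdsWithin 0 (Set.Ioi 0))
      (nhds (condEntropy M + condEntropy N)) := by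
    have := ((continuous_condEntropy_add_smul_one hM).tendsto 0).add
      ((continuous_condEntropy_add_smul_one hN).tendsto 0)
    simp only [Complex.ofReal_zero, zero_smul, add_zero] at this
    exact this.mono_left nhdsWithin_le_nhds
  have l2 : Filter.Tendsto (fun t : ℝ => condEntropy (M + N + ((2 * t : ℝ) : ℂ) • 1))
      (nhdsWithin 0 (Set.Ioi 0)) (nhds (condEntropy (M + N))) := by
    have := ((continuous_condEntropy_add_smul_one (hM.add hN)).comp
      (continuous_const_mul (2 : ℝ))).tendsto 0
    simp only [Function.comp_apply, mul_zero, Complex.ofReal_zero, zero_smul, add_zero] at this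
    exact this.mono_left nhdsWithin_le_nhds
  exact le_of_tendsto_of_tendsto l1 l2 (Filter.eventually_of_mem self_mem_nhdsWithin key)

end StrongSubadditivity

/-! ### Continuity of the conditional entropy -/

section Continuity

variable {A B : Type*} [Fintype A] [DecidableEq A] [Fintype B] [DecidableEq B]

/-- The Alicki–Fannes–Winter bound. -/
lemma condEntropy_sub_le {M M' N N' : Matrix (B × A) (B × A) ℂ} (hM : M.PosSemidef)
    (hM' : M'.PosSemidef) (hN : N.PosSemidef) (hN' : N'.PosSemidef) (h : M + N = M' + N')
    (h1 : M'.trace = 1) {ε : ℝ} (hε : 0 < ε) (hNε : N.trace.re ≤ ε) (hNε' : N'.trace.re ≤ ε) :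
    condEntropy M - condEntropy M' ≤ 2 * ε * Real.log (Fintype.card A) +
      (Real.log (1 + ε) + ε * (Real.log (1 + ε) - Real.log ε)) := by
  -- Superadditivity handles M + N. For M' + N', joint entropy is subadditive while the marginals
  -- lose at most the mixing term. The remainders `N` and `N'` each cost ε log |A|.
  have a1 := condEntropy_add_le hM hN
  have a2 := natEntropy_add_le hM' hN'
  have a3 := natEntropy_add_natEntropy_le (posSemidef_traceLast hM') (posSemidef_traceLast hN') hε
  have a4 := neg_le_condEntropy hN
  have a5 := condEntropy_le hN'
  have hd : 0 ≤ Real.log (Fintype.card A) := Real.log_natCast_nonneg _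
  have hl : Real.log ε ≤ Real.log (1 + ε) := Real.log_le_log hε (by linarith)
  have b1 := mul_le_mul_of_nonneg_right hNε hd
  have b2 := mul_le_mul_of_nonneg_right hNε' hd
  have b3 := mul_le_mul_of_nonneg_right hNε' (sub_nonneg.mpr hl)
  rw [trace_traceLast, trace_traceLast, h1, Complex.one_re, one_mul] at a3
  rw [h] at a1
  have e1 : condEntropy (M' + N') = natEntropy (M' + N') - natEntropy (traceLast M' + traceLast N')
    := by rw [condEntropy, traceLast_add]
  have e2 : condEntropy M' = natEntropy M' - natEntropy (traceLast M') := rfl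
  have e3 : condEntropy N' = natEntropy N' - natEntropy (traceLast N') := rfl
  linarith

end Continuity

/-! ### Local instruments on a bipartite state -/

section BlockMat

variable {Z Y : Type*} [DecidableEq Z]

lemma blockMat_add (N N' : Z → Matrix Y Y ℂ) :
    blockMat (fun z => N z + N' z) = blockMat N + blockMat N' := by
  ext i j
  by_cases h : i.1 = j.1 <;> simp [blockMat, h]

lemma isHermitian_blockMat {N : Z → Matrix Y Y ℂ} (h : ∀ z, (N z).IsHermitian) :
    (blockMat N).IsHermitian := by
  ext i j
  rw [conjTranspose_apply, blockMat, of_apply, of_apply]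
  by_cases hij : i.1 = j.1
  · rw [if_pos hij, if_pos hij.symm, hij, ← conjTranspose_apply, (h _).eq]
  · rw [if_neg hij, if_neg (Ne.symm hij), star_zero]

variable [Fintype Z] [Fintype Y]

lemma posSemidef_blockMat [DecidableEq Y] {N : Z → Matrix Y Y ℂ} (h : ∀ z, (N z).PosSemidef) :
    (blockMat N).PosSemidef := by
  choose K hK using fun z => exists_eq_mul_conjTranspose (h z)
  have e : blockMat N = blockMat K * (blockMat K)ᴴ := by
    ext ⟨z, y⟩ ⟨z', y'⟩
    simp only [blockMat, mul_apply, of_apply, conjTranspose_apply, Fintype.sum_prod_type, ite_mul,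
      zero_mul, apply_ite star, star_zero, mul_ite, mul_zero]
    rw [Finset.sum_eq_single z]
    · by_cases hz : z = z'
      · subst hz
        simp [hK z, mul_apply]
      · simp [hz, Ne.symm hz]
    · intro w _ hw
      simp [hw.symm]
    · simp
  rw [e]
  exact posSemidef_self_mul_conjTranspose _

lemma trace_blockMat (N : Z → Matrix Y Y ℂ) : (blockMat N).trace = ∑ z, (N z).trace := by
  simp [Matrix.trace, blockMat, Fintype.sum_prod_type]

end BlockMat

section Instrument

variable {A B E Z : Type*} [Fintype A] [Fintype B] [DecidableEq B] [Fintype E] [Fintype Z]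
  [DecidableEq Z]

/-- The operator `K` on `A` acting on `AB`, with the output ordered as `BA`. -/
def localOp (B : Type*) [DecidableEq B] (K : Matrix A A ℂ) : Matrix (B × A) (A × B) ℂ :=
  (K.kronecker (1 : Matrix B B ℂ)).submatrix (Equiv.prodComm B A) id

lemma localOp_conjTranspose_mul_self (K : Matrix A A ℂ) :
    (localOp B K)ᴴ * localOp B K = (Kᴴ * K).kronecker (1 : Matrix B B ℂ) := by
  rw [localOp, conjTranspose_submatrix, submatrix_mul_equiv, submatrix_id_id, kronecker,
    conjTranspose_kronecker, ← mul_kronecker_mul, conjTranspose_one, Matrix.one_mul]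

/-- The output `∑ z, |z⟩⟨z| ⊗ K_z ρ K_z†` of a local instrument on `A`, on the system `(ZB)A`. -/
def instrument (K : Z → Matrix A A ℂ) (ρ : Matrix (A × B) (A × B) ℂ) :
    Matrix ((Z × B) × A) ((Z × B) × A) ℂ :=
  (blockMat fun z => localOp B (K z) * ρ * (localOp B (K z))ᴴ).submatrix
    (Equiv.prodAssoc Z B A) (Equiv.prodAssoc Z B A)

omit [Fintype Z] in
lemma instrument_add (K : Z → Matrix A A ℂ) (ρ σ : Matrix (A × B) (A × B) ℂ) :
    instrument K (ρ + σ) = instrument K ρ + instrument K σ := by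
  simp only [instrument, Matrix.mul_add, Matrix.add_mul, blockMat_add]
  rfl

lemma posSemidef_instrument [DecidableEq A] (K : Z → Matrix A A ℂ) {ρ : Matrix (A × B) (A × B) ℂ}
    (hρ : ρ.PosSemidef) : (instrument K ρ).PosSemidef :=
  (posSemidef_blockMat fun z => hρ.mul_mul_conjTranspose_same (localOp B (K z))).submatrix _

lemma trace_instrument [DecidableEq A] {K : Z → Matrix A A ℂ} (hK : ∑ z, (K z)ᴴ * K z = 1)
    (ρ : Matrix (A × B) (A × B) ℂ) : (instrument K ρ).trace = ρ.trace := by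
  have h : (instrument K ρ).trace =
      (blockMat fun z => localOp B (K z) * ρ * (localOp B (K z))ᴴ).trace :=
    Equiv.sum_comp (Equiv.prodAssoc Z B A) fun i =>
      (blockMat fun z => localOp B (K z) * ρ * (localOp B (K z))ᴴ) i i
  have h2 : ∀ z, (localOp B (K z) * ρ * (localOp B (K z))ᴴ).trace =
      (((K z)ᴴ * K z).kronecker (1 : Matrix B B ℂ) * ρ).trace := by
    intro z
    rw [trace_mul_comm, ← Matrix.mul_assoc, localOp_conjTranspose_mul_self]
  have h3 : ∑ z, ((K z)ᴴ * K z).kronecker (1 : Matrix B B ℂ) = 1 := by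
    rw [← one_kronecker_one, ← hK]
    ext i j
    simp [Matrix.sum_apply, kronecker, Finset.sum_mul]
  rw [h, trace_blockMat, Finset.sum_congr rfl fun z _ => h2 z, ← trace_sum, ← Finset.sum_mul, h3,
    Matrix.one_mul]

/-! ### The measured state of a purification -/

/-- The state of `ZB` after a measurement of `A` with effects `P` on the pure state `ψ` of `ABE`. -/
def measuredB (ψ : (A × B) × E → ℂ) (P : Z → Matrix A A ℂ) : Matrix (Z × B) (Z × B) ℂ :=
  blockMat fun z => of fun b b' =>
    ∑ e, ∑ a, ∑ a', ψ ((a, b), e) * star (ψ ((a', b'), e)) * P z a' a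

/-- The state of `ZE` after a measurement of `A` with effects `P` on the pure state `ψ` of `ABE`. -/
def measuredE (ψ : (A × B) × E → ℂ) (P : Z → Matrix A A ℂ) : Matrix (Z × E) (Z × E) ℂ :=
  blockMat fun z => of fun e e' =>
    ∑ b, ∑ a, ∑ a', ψ ((a, b), e) * star (ψ ((a', b), e')) * P z a' a

/-- The pure state `ψ` of `ABE` as an operator from `E` to `AB`. -/
def purificationMat (ψ : (A × B) × E → ℂ) : Matrix (A × B) E ℂ :=
  of fun i e => ψ (i, e)

omit [Fintype A] [Fintype B] [DecidableEq B] in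
lemma IsPurification.eq_mul {ψ : (A × B) × E → ℂ} {ρ : Matrix (A × B) (A × B) ℂ}
    (h : IsPurification ψ ρ) : ρ = purificationMat ψ * (purificationMat ψ)ᴴ := by
  rw [← h]
  ext i j
  simp [traceLast, ketbra, vecMulVec_apply, mul_apply, purificationMat]

omit [Fintype E] in
lemma localOp_mul_apply (K : Matrix A A ℂ) (ψ : (A × B) × E → ℂ) (b : B) (c : A) (e : E) :
    (localOp B K * purificationMat ψ) (b, c) e = ∑ a, K c a * ψ ((a, b), e) := by
  simp [mul_apply, localOp, kronecker, purificationMat, Fintype.sum_prod_type, one_apply]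

omit [Fintype E] in
lemma sum_localOp_mul (K : Matrix A A ℂ) (ψ : (A × B) × E → ℂ) (b b' : B) (e e' : E) :
    ∑ c, (localOp B K * purificationMat ψ) (b, c) e *
        star ((localOp B K * purificationMat ψ) (b', c) e') =
      ∑ a, ∑ a', ψ ((a, b), e) * star (ψ ((a', b'), e')) * (Kᴴ * K) a' a := by
  simp only [localOp_mul_apply, star_sum, Finset.sum_mul_sum, star_mul']
  simp only [mul_apply, conjTranspose_apply, Finset.mul_sum]
  rw [Finset.sum_comm]
  refine Finset.sum_congr rfl fun a _ => ?_
  rw [Finset.sum_comm]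
  refine Finset.sum_congr rfl fun a' _ => Finset.sum_congr rfl fun c _ => ?_
  ring

omit [Fintype Z] in
lemma traceLast_instrument {ψ : (A × B) × E → ℂ} {ρ : Matrix (A × B) (A × B) ℂ}
    (h : IsPurification ψ ρ) (K : Z → Matrix A A ℂ) :
    traceLast (instrument K ρ) = measuredB ψ fun z => (K z)ᴴ * K z := by
  ext ⟨z, b⟩ ⟨z', b'⟩
  by_cases hz : z = z'
  · subst hz
    have e : ∀ z, localOp B (K z) * ρ * (localOp B (K z))ᴴ =
        (localOp B (K z) * purificationMat ψ) * (localOp B (K z) * purificationMat ψ)ᴴ := by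
      intro z
      rw [h.eq_mul, conjTranspose_mul]
      simp only [Matrix.mul_assoc]
    simp only [traceLast, instrument, measuredB, blockMat, of_apply, submatrix_apply,
      Equiv.prodAssoc_apply, if_true, e, ← sum_localOp_mul]
    rw [Finset.sum_comm]
    exact Finset.sum_congr rfl fun c _ => Matrix.mul_apply
  · simp [traceLast, instrument, measuredB, blockMat, hz]

omit [Fintype E] in
-- For G = (K ⊗ 1)ψ, viewed as an operator from `E` to `BA`, the `E`-block is the transpose of GᴴG,
-- while the corresponding block of the instrument output is GGᴴ.
lemma measuredE_block (K : Matrix A A ℂ) (ψ : (A × B) × E → ℂ) :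
    (of fun e e' => ∑ b, ∑ a, ∑ a', ψ ((a, b), e) * star (ψ ((a', b), e')) * (Kᴴ * K) a' a) =
      ((localOp B K * purificationMat ψ)ᴴ * (localOp B K * purificationMat ψ))ᵀ := by
  ext e e'
  simp only [of_apply, ← sum_localOp_mul, transpose_apply]
  refine Eq.trans ?_ Matrix.mul_apply.symm
  rw [Fintype.sum_prod_type]
  exact Finset.sum_congr rfl fun b _ => Finset.sum_congr rfl fun c _ => mul_comm _ _

omit [Fintype E] [Fintype Z] in
lemma isHermitian_measuredE (ψ : (A × B) × E → ℂ) (K : Z → Matrix A A ℂ) :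
    (measuredE ψ fun z => (K z)ᴴ * K z).IsHermitian := by
  simp only [measuredE, measuredE_block]
  exact isHermitian_blockMat fun z => (isHermitian_conjTranspose_mul_self _).transpose

/-- For each outcome the state on `BAE` is pure, so its `E` and `BA` marginals have equal entropy.
-/
lemma natEntropy_measuredE [DecidableEq A] [DecidableEq E] {ψ : (A × B) × E → ℂ}
    {ρ : Matrix (A × B) (A × B) ℂ} (h : IsPurification ψ ρ) (K : Z → Matrix A A ℂ) :
    natEntropy (measuredE ψ fun z => (K z)ᴴ * K z) = natEntropy (instrument K ρ) := by
  simp only [measuredE, measuredE_block]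
  rw [instrument, natEntropy_submatrix_equiv, natEntropy_blockMat, natEntropy_blockMat]
  refine Finset.sum_congr rfl fun z _ => ?_
  rw [natEntropy_transpose, ← natEntropy_mul_comm, h.eq_mul, conjTranspose_mul]
  simp only [Matrix.mul_assoc]

omit [DecidableEq B] in
lemma IsPurification.posSemidef {ψ : (A × B) × E → ℂ} {ρ : Matrix (A × B) (A × B) ℂ}
    (h : IsPurification ψ ρ) : ρ.PosSemidef := by
  rw [h.eq_mul]
  exact posSemidef_self_mul_conjTranspose _

/-- The environment is eliminated: the entropy difference is a conditional entropy of `AB`. -/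
lemma entropy_measuredB_sub_measuredE [DecidableEq A] [DecidableEq E] {ψ : (A × B) × E → ℂ}
    {ρ : Matrix (A × B) (A × B) ℂ} (h : IsPurification ψ ρ) (K : Z → Matrix A A ℂ) :
    entropy (measuredB ψ fun z => (K z)ᴴ * K z) - entropy (measuredE ψ fun z => (K z)ᴴ * K z) =
      -condEntropy (instrument K ρ) / Real.log 2 := by
  have hB : (measuredB ψ fun z => (K z)ᴴ * K z).IsHermitian := by
    rw [← traceLast_instrument h]
    exact (posSemidef_traceLast (posSemidef_instrument K h.posSemidef)).1
  rw [entropy_eq_natEntropy hB, entropy_eq_natEntropy (isHermitian_measuredE ψ K),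
    natEntropy_measuredE h, ← traceLast_instrument h, condEntropy]
  ring

end Instrument

/-! ### Key value as a difference of conditional entropies -/

section KeyValue

variable {A B E X T : Type*} [Fintype A] [Fintype B] [DecidableEq B] [Fintype E] [Fintype X]
  [DecidableEq X] [Fintype T] [DecidableEq T]

omit [Fintype B] [DecidableEq B] [Fintype X] [Fintype T] in
lemma traceLast_measuredState (ψ : (A × B) × E → ℂ) (Q : X → Matrix A A ℂ) (R : X → T → ℝ) :
    traceLast (measuredState (ketbra ψ) Q R) =
      measuredB ψ fun z : T × X => (R z.2 z.1 : ℂ) • Q z.2 := by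
  ext ⟨z, b⟩ ⟨z', b'⟩
  by_cases hz : z = z'
  · subst hz
    simp [traceLast, measuredState, measuredB, blockMat, ketbra, vecMulVec_apply, Finset.mul_sum,
      mul_left_comm]
  · simp [traceLast, measuredState, measuredB, blockMat, hz]

omit [DecidableEq B] [Fintype E] [Fintype X] [Fintype T] in
lemma traceMid_measuredState (ψ : (A × B) × E → ℂ) (Q : X → Matrix A A ℂ) (R : X → T → ℝ) :
    traceMid (measuredState (ketbra ψ) Q R) =
      measuredE ψ fun z : T × X => (R z.2 z.1 : ℂ) • Q z.2 := by
  ext ⟨z, e⟩ ⟨z', e'⟩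
  by_cases hz : z = z'
  · subst hz
    simp [traceMid, measuredState, measuredE, blockMat, ketbra, vecMulVec_apply, Finset.mul_sum,
      mul_left_comm]
  · simp [traceMid, measuredState, measuredE, blockMat, hz]

omit [Fintype B] [DecidableEq B] [Fintype T] in
lemma traceMid_measuredB (ψ : (A × B) × E → ℂ) (P : T × X → Matrix A A ℂ) :
    traceMid (measuredB ψ P) = measuredB ψ fun t => ∑ x, P (t, x) := by
  ext ⟨t, b⟩ ⟨t', b'⟩
  by_cases ht : t = t'
  · subst ht
    simp only [traceMid, measuredB, blockMat, of_apply, if_true, Matrix.sum_apply, Finset.mul_sum]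
    rw [Finset.sum_comm]
    refine Finset.sum_congr rfl fun e _ => ?_
    rw [Finset.sum_comm]
    refine Finset.sum_congr rfl fun a _ => ?_
    rw [Finset.sum_comm]
  · simp [traceMid, measuredB, blockMat, ht]

omit [DecidableEq B] [Fintype E] [Fintype T] in
lemma traceMid_measuredE (ψ : (A × B) × E → ℂ) (P : T × X → Matrix A A ℂ) :
    traceMid (measuredE ψ P) = measuredE ψ fun t => ∑ x, P (t, x) := by
  ext ⟨t, e⟩ ⟨t', e'⟩
  by_cases ht : t = t'
  · subst ht
    simp only [traceMid, measuredE, blockMat, of_apply, if_true, Matrix.sum_apply, Finset.mul_sum]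
    rw [Finset.sum_comm]
    refine Finset.sum_congr rfl fun b _ => ?_
    rw [Finset.sum_comm]
    refine Finset.sum_congr rfl fun a _ => ?_
    rw [Finset.sum_comm]
  · simp [traceMid, measuredE, blockMat, ht]

omit [DecidableEq B] [Fintype X] [DecidableEq X] [Fintype T] [DecidableEq T] in
lemma traceLast_traceMid {Z : Type*} (ω : Matrix ((Z × B) × E) ((Z × B) × E) ℂ) :
    traceLast (traceMid ω) = traceLast (traceLast ω) := by
  ext i j
  simp only [traceLast, traceMid, of_apply]
  exact Finset.sum_comm

/-- The key value of a protocol is a difference of two conditional entropies of `AB` after local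
instruments that depend on the protocol only. -/
lemma condMutualInfo_sub_eq [DecidableEq A] [DecidableEq E] {Q : X → Matrix A A ℂ} {R : X → T → ℝ}
    {K : T × X → Matrix A A ℂ} {L : T → Matrix A A ℂ}
    (hK : ∀ t x, (R x t : ℂ) • Q x = (K (t, x))ᴴ * K (t, x))
    (hL : ∀ t, ∑ x, (R x t : ℂ) • Q x = (L t)ᴴ * L t)
    {ψ : (A × B) × E → ℂ} {ρ : Matrix (A × B) (A × B) ℂ} (h : IsPurification ψ ρ) :
    condMutualInfo (traceLast (measuredState (ketbra ψ) Q R))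
        - condMutualInfo (traceMid (measuredState (ketbra ψ) Q R)) =
      (condEntropy (instrument K ρ) - condEntropy (instrument L ρ)) / Real.log 2 := by
  have e1 := entropy_measuredB_sub_measuredE h K
  have e2 := entropy_measuredB_sub_measuredE h L
  have hK' : (fun z : T × X => (R z.2 z.1 : ℂ) • Q z.2) = fun z => (K z)ᴴ * K z :=
    funext fun z => hK z.1 z.2
  have hL' : (fun t : T => ∑ x, (K (t, x))ᴴ * K (t, x)) = fun t => (L t)ᴴ * L t := by
    funext t
    simp only [← hK, hL]
  -- S(TX) and S(T) occur in both informations and cancel, leaving the pairs treated by `e1` and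
  -- `e2`.
  rw [condMutualInfo, condMutualInfo, traceLast_traceMid, traceLast_measuredState,
    traceMid_measuredState, hK', traceMid_measuredB, traceMid_measuredE, hL', sub_div]
  rw [neg_div] at e1 e2
  linarith

omit [DecidableEq X] [DecidableEq T] in
-- The coarse-grained effect for t gets its own single Kraus operator `L t`: forgetting x after
-- applying `K` would leave a mixed state given t and break the purity argument.
lemma exists_kraus [DecidableEq A] {Q : X → Matrix A A ℂ} {R : X → T → ℝ} (hQ : IsPOVM Q)
    (hR : IsClassicalChannel R) :
    ∃ (K : T × X → Matrix A A ℂ) (L : T → Matrix A A ℂ),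
      (∀ t x, (R x t : ℂ) • Q x = (K (t, x))ᴴ * K (t, x)) ∧
      (∀ t, ∑ x, (R x t : ℂ) • Q x = (L t)ᴴ * L t) ∧
      ∑ z, (K z)ᴴ * K z = 1 ∧ ∑ t, (L t)ᴴ * L t = 1 := by
  have hP : ∀ z : T × X, ((R z.2 z.1 : ℂ) • Q z.2).PosSemidef := fun z =>
    (hQ.1 z.2).smul (by exact_mod_cast hR.1 z.2 z.1)
  have hS : ∀ t : T, (∑ x, (R x t : ℂ) • Q x).PosSemidef := fun t =>
    posSemidef_sum _ fun x _ => hP (t, x)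
  have hsum : ∑ t, ∑ x, (R x t : ℂ) • Q x = 1 := by
    rw [Finset.sum_comm, ← hQ.2]
    refine Finset.sum_congr rfl fun x _ => ?_
    rw [← Finset.sum_smul, ← Complex.ofReal_sum, hR.2 x, Complex.ofReal_one, one_smul]
  choose K hK using fun z => exists_eq_mul_conjTranspose (hP z)
  choose L hL using fun t => exists_eq_mul_conjTranspose (hS t)
  refine ⟨fun z => (K z)ᴴ, fun t => (L t)ᴴ, fun t x => ?_, fun t => ?_, ?_, ?_⟩
  · rw [conjTranspose_conjTranspose]
    exact hK (t, x)
  · rw [conjTranspose_conjTranspose]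
    exact hL t
  · simp only [conjTranspose_conjTranspose, ← hK]
    rw [Fintype.sum_prod_type]
    exact hsum
  · simp only [conjTranspose_conjTranspose, ← hL]
    exact hsum

end KeyValue

/-! ### Positive and negative parts -/

section Jordan

variable {n : Type*} [Fintype n] [DecidableEq n]

lemma IsDiagonalization.sum_comp_eq {M U V : Matrix n n ℂ} {p q : n → ℝ}
    (h : IsDiagonalization M U p) (h' : IsDiagonalization M V q) (f : ℝ → ℝ) :
    ∑ i, f (p i) = ∑ i, f (q i) := by
  have e := h.charpoly.symm.trans h'.charpoly
  have e' := congrArg (fun P : Polynomial ℂ => (P.roots.map fun z => f z.re).sum) e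
  simp only [roots_prod_X_sub_C, Multiset.map_map] at e'
  exact e'

lemma traceNorm_eq {M U : Matrix n n ℂ} {p : n → ℝ} (h : IsDiagonalization M U p) :
    traceNorm M = ∑ i, |p i| := by
  have hM : M.IsHermitian := by
    rw [h.2]
    refine isHermitian_mul_mul_conjTranspose U ?_
    rw [IsHermitian, diagonal_conjTranspose]
    congr 1
    ext i
    rw [Pi.star_apply, Complex.star_def, Complex.conj_ofReal]
  have h2 : IsDiagonalization (Mᴴ * M) U (fun i => p i ^ 2) := by
    refine IsDiagonalization.of_conj h.1 ?_
    have e : Uᴴ * (Mᴴ * M) * U = (Uᴴ * M * U) * (Uᴴ * M * U) := by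
      rw [hM.eq]
      calc Uᴴ * (M * M) * U = Uᴴ * M * 1 * (M * U) := by
            simp only [Matrix.mul_assoc, Matrix.one_mul]
        _ = _ := by rw [← h.mul_conjTranspose]; simp only [Matrix.mul_assoc]
    rw [e, h.conj_eq, diagonal_mul_diagonal]
    congr 1
    ext i
    push_cast
    ring
  have h3 := exists_isDiagonalization (isHermitian_conjTranspose_mul_self M)
  rw [traceNorm, h3.sum_comp_eq h2 Real.sqrt]
  simp only [Real.sqrt_sq_eq_abs]

/-- The Jordan decomposition of a traceless Hermitian matrix. -/
lemma exists_posSemidef_sub {M : Matrix n n ℂ} (hM : M.IsHermitian) (h0 : M.trace = 0) :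
    ∃ P N : Matrix n n ℂ, P.PosSemidef ∧ N.PosSemidef ∧ M = P - N ∧
      P.trace = ((traceNorm M / 2 : ℝ) : ℂ) ∧ N.trace = ((traceNorm M / 2 : ℝ) : ℂ) := by
  have h := exists_isDiagonalization hM
  set U := (hM.eigenvectorUnitary : Matrix n n ℂ)
  set p := hM.eigenvalues
  have hp0 : ∑ i, p i = 0 := by
    have := h.trace
    rw [h0] at this
    exact_mod_cast this.symm
  have hpos : ∀ q : n → ℝ, (∀ i, 0 ≤ q i) →
      (U * diagonal (fun i => (q i : ℂ)) * Uᴴ).PosSemidef := fun q hq =>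
    (PosSemidef.diagonal fun i => Complex.zero_le_real.mpr (hq i)).mul_mul_conjTranspose_same U
  have htr : ∀ q : n → ℝ, (U * diagonal (fun i => (q i : ℂ)) * Uᴴ).trace = ((∑ i, q i : ℝ) : ℂ) :=
    fun q => IsDiagonalization.trace ⟨h.1, rfl⟩
  have hs : ∑ i, (p i)⁺ - ∑ i, (p i)⁻ = 0 := by
    rw [← Finset.sum_sub_distrib, ← hp0]
    simp only [posPart_sub_negPart]
  have ha : ∑ i, (p i)⁺ + ∑ i, (p i)⁻ = traceNorm M := by
    rw [← Finset.sum_add_distrib, traceNorm_eq h]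
    simp only [posPart_add_negPart]
  refine ⟨_, _, hpos (fun i => (p i)⁺) fun i => posPart_nonneg _,
    hpos (fun i => (p i)⁻) fun i => negPart_nonneg _, ?_, ?_, ?_⟩
  · rw [← Matrix.sub_mul, ← Matrix.mul_sub, diagonal_sub]
    conv_lhs => rw [h.2]
    congr 3
    ext i
    rw [← Complex.ofReal_sub, posPart_sub_negPart]
  · rw [htr]
    congr 1
    linarith
  · rw [htr]
    congr 1
    linarith

end Jordan

/-! ### Binary entropy -/

lemma binaryEntropy_eq (x : ℝ) : binaryEntropy x = Real.binEntropy x / Real.log 2 := by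
  rw [binaryEntropy, Real.binEntropy, Real.logb, Real.logb, Real.log_inv, Real.log_inv]
  ring

lemma log_one_sub_le {x : ℝ} (h0 : 0 ≤ x) (h1 : x < 1) : Real.log (1 - x) ≤ -x - x ^ 2 / 2 := by
  have h := Real.hasSum_pow_div_log_of_abs_lt_one (x := x) (by rwa [abs_of_nonneg h0])
  have := sum_le_hasSum (Finset.range 2) (fun i _ => by positivity) h
  norm_num [Finset.sum_range_succ] at this
  linarith

/-- Absorbs the mixing term at ε = δ/2 into h(δ). After the logarithmic estimates, the remaining
polynomial is exactly that of `b4`, nonnegative because δ ≤ 1/2. -/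
lemma mixing_le_binEntropy {δ : ℝ} (h0 : 0 < δ) (h1 : δ ≤ 1 / 2) :
    Real.log (1 + δ / 2) + δ / 2 * (Real.log (1 + δ / 2) - Real.log (δ / 2)) ≤
      Real.binEntropy δ := by
  have a1 := log_one_sub_le h0.le (by linarith)
  have a2 := Real.log_le_sub_one_of_pos (show 0 < 1 + δ / 2 by positivity)
  have a3 := Real.log_le_sub_one_of_pos (show 0 < 2 * δ by positivity)
  rw [Real.log_mul two_ne_zero h0.ne'] at a3
  rw [Real.binEntropy, Real.log_inv, Real.log_inv, Real.log_div h0.ne' two_ne_zero]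
  have b1 := mul_le_mul_of_nonneg_left a1 (show 0 ≤ 1 - δ by linarith)
  have b2 := mul_le_mul_of_nonneg_left a2 (show 0 ≤ 1 + δ / 2 by positivity)
  have b3 := mul_le_mul_of_nonneg_left a3 (show 0 ≤ δ / 2 by positivity)
  have b4 : 0 ≤ δ * ((1 / 2 - δ) * (2 + δ / 2)) := by
    have : 0 ≤ 1 / 2 - δ := by linarith
    positivity
  nlinarith

/-! ### Continuity of the one-way key -/

section Key

variable {A B E E' : Type*} [Fintype A] [DecidableEq A] [Fintype B] [DecidableEq B]
  [Fintype E] [DecidableEq E] [Fintype E'] [DecidableEq E']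

lemma abs_condEntropy_instrument_sub_le {ρ ρ' : Matrix (A × B) (A × B) ℂ} (hρ : IsState ρ)
    (hρ' : IsState ρ') {δ : ℝ} (hδ : δ ≤ 1 / 2) (hclose : traceNorm (ρ - ρ') ≤ δ)
    {Z : Type*} [Fintype Z] [DecidableEq Z] {K : Z → Matrix A A ℂ}
    (hK : ∑ z, (K z)ᴴ * K z = 1) :
    |condEntropy (instrument K ρ) - condEntropy (instrument K ρ')| ≤
      δ * Real.log (Fintype.card A) + Real.binEntropy δ := by
  obtain ⟨P, N, hP, hN, hPN, htP, htN⟩ := exists_posSemidef_sub (hρ.1.1.sub hρ'.1.1)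
    (by rw [trace_sub, hρ.2, hρ'.2, sub_self])
  have h0 : 0 ≤ traceNorm (ρ - ρ') := Finset.sum_nonneg fun i _ => Real.sqrt_nonneg _
  -- The mixing bound needs ε > 0; at δ = 0 the two states coincide.
  rcases (h0.trans hclose).eq_or_lt with rfl | hpos
  · rw [le_antisymm hclose h0, zero_div, Complex.ofReal_zero] at htP htN
    rw [hP.trace_eq_zero_iff.mp htP, hN.trace_eq_zero_iff.mp htN, sub_zero, sub_eq_zero] at hPN
    simp [hPN]
  have e : ρ + N = ρ' + P := by
    have : ρ = ρ' + (P - N) := by rw [← hPN]; abel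
    rw [this]
    abel
  have e' := congrArg (instrument K) e
  rw [instrument_add, instrument_add] at e'
  have tP : (instrument K P).trace.re ≤ δ / 2 := by
    rw [trace_instrument hK, htP, Complex.ofReal_re]
    linarith
  have tN : (instrument K N).trace.re ≤ δ / 2 := by
    rw [trace_instrument hK, htN, Complex.ofReal_re]
    linarith
  have c1 := condEntropy_sub_le (posSemidef_instrument K hρ.1) (posSemidef_instrument K hρ'.1)
    (posSemidef_instrument K hN) (posSemidef_instrument K hP) e'
    (by rw [trace_instrument hK, hρ'.2]) (half_pos hpos) tN tP
  have c2 := condEntropy_sub_le (posSemidef_instrument K hρ'.1) (posSemidef_instrument K hρ.1)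
    (posSemidef_instrument K hP) (posSemidef_instrument K hN) e'.symm
    (by rw [trace_instrument hK, hρ.2]) (half_pos hpos) tP tN
  have c3 := mixing_le_binEntropy hpos hδ
  rw [mul_div_cancel₀ δ two_ne_zero] at c1 c2
  rw [abs_le]
  constructor <;> linarith

lemma abs_condEntropy_instrument_le {ρ : Matrix (A × B) (A × B) ℂ} (hρ : IsState ρ)
    {Z : Type*} [Fintype Z] [DecidableEq Z] {K : Z → Matrix A A ℂ}
    (hK : ∑ z, (K z)ᴴ * K z = 1) :
    |condEntropy (instrument K ρ)| ≤ Real.log (Fintype.card A) := by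
  have h1 := condEntropy_le (posSemidef_instrument K hρ.1)
  have h2 := neg_le_condEntropy (posSemidef_instrument K hρ.1)
  rw [trace_instrument hK, hρ.2, Complex.one_re, one_mul] at h1 h2
  exact abs_le.mpr ⟨h2, h1⟩

/-- The values attained in the optimization defining the one-way key. -/
def keyValues (ρ : Matrix ((A × B) × E) ((A × B) × E) ℂ) : Set ℝ :=
  {r : ℝ | ∃ (m k : ℕ) (Q : Fin m → Matrix A A ℂ) (R : Fin m → Fin k → ℝ),
    IsPOVM Q ∧ IsClassicalChannel R ∧
      r = condMutualInfo (traceLast (measuredState ρ Q R))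
        - condMutualInfo (traceMid (measuredState ρ Q R))}

lemma keyValues_nonempty (ρ : Matrix ((A × B) × E) ((A × B) × E) ℂ) : (keyValues ρ).Nonempty :=
  ⟨_, 1, 1, fun _ => 1, fun _ _ => 1, ⟨fun _ => PosSemidef.one, by simp⟩,
    ⟨fun _ _ => zero_le_one, by simp⟩, rfl⟩

lemma bddAbove_keyValues {ρ : Matrix (A × B) (A × B) ℂ} (hρ : IsState ρ) {ψ : (A × B) × E → ℂ}
    (hψ : IsPurification ψ ρ) : BddAbove (keyValues (ketbra ψ)) := by
  refine ⟨2 * Real.log (Fintype.card A) / Real.log 2, ?_⟩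
  rintro r ⟨m, k, Q, R, hQ, hR, rfl⟩
  obtain ⟨K, L, hK, hL, hK1, hL1⟩ := exists_kraus hQ hR
  rw [condMutualInfo_sub_eq hK hL hψ]
  have h1 := abs_le.mp (abs_condEntropy_instrument_le hρ hK1)
  have h2 := abs_le.mp (abs_condEntropy_instrument_le hρ hL1)
  exact div_le_div_of_nonneg_right (by linarith) (Real.log_nonneg one_le_two)

lemma oneWayKey_le_add {ρ ρ' : Matrix (A × B) (A × B) ℂ} (hρ : IsState ρ) (hρ' : IsState ρ')
    {δ : ℝ} (hδ : δ ≤ 1 / 2) (hclose : traceNorm (ρ - ρ') ≤ δ)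
    {ψ : (A × B) × E → ℂ} (hψ : IsPurification ψ ρ)
    {ψ' : (A × B) × E' → ℂ} (hψ' : IsPurification ψ' ρ') :
    oneWayKey (ketbra ψ) ≤ oneWayKey (ketbra ψ') +
      2 * (δ * Real.log (Fintype.card A) + Real.binEntropy δ) / Real.log 2 := by
  refine csSup_le (keyValues_nonempty (ketbra ψ)) ?_
  rintro r ⟨m, k, Q, R, hQ, hR, rfl⟩
  obtain ⟨K, L, hK, hL, hK1, hL1⟩ := exists_kraus hQ hR
  -- The same protocol, hence the same `K` and `L`, is tested on the other state. Boundedness is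
  -- needed for the real supremum to dominate its elements.
  have h' := le_csSup (bddAbove_keyValues hρ' hψ') ⟨m, k, Q, R, hQ, hR, rfl⟩
  change _ ≤ oneWayKey (ketbra ψ') at h'
  rw [condMutualInfo_sub_eq hK hL hψ'] at h'
  rw [condMutualInfo_sub_eq hK hL hψ]
  have h1 := abs_le.mp (abs_condEntropy_instrument_sub_le hρ hρ' hδ hclose hK1)
  have h2 := abs_le.mp (abs_condEntropy_instrument_sub_le hρ hρ' hδ hclose hL1)
  refine le_trans ?_ (add_le_add_left h' _)
  rw [← add_div]
  exact div_le_div_of_nonneg_right (by linarith) (Real.log_nonneg one_le_two)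

lemma traceNorm_sub_comm {n : Type*} [Fintype n] [DecidableEq n] (M N : Matrix n n ℂ) :
    traceNorm (M - N) = traceNorm (N - M) := by
  have h : (M - N)ᴴ * (M - N) = (N - M)ᴴ * (N - M) := by
    rw [← neg_sub N M, conjTranspose_neg, neg_mul_neg]
  simp only [traceNorm, h]

end Key

end OneWayKey

end
-- The continuity bound
theorem mainTheorem11 {A B E E' : Type*} [Fintype A] [DecidableEq A] [Fintype B] [DecidableEq B]
    [Fintype E] [DecidableEq E] [Fintype E'] [DecidableEq E']
    (ρ ρ' : Matrix (A × B) (A × B) ℂ)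
    (hρ : OneWayKey.IsState ρ) (hρ' : OneWayKey.IsState ρ')
    (δ : ℝ) (hδ : δ ≤ 1 / 2) (hclose : OneWayKey.traceNorm (ρ - ρ') ≤ δ)
    (ψ : (A × B) × E → ℂ) (hψ : OneWayKey.IsPurification ψ ρ)
    (ψ' : (A × B) × E' → ℂ) (hψ' : OneWayKey.IsPurification ψ' ρ') :
    |OneWayKey.oneWayKey (OneWayKey.ketbra ψ) - OneWayKey.oneWayKey (OneWayKey.ketbra ψ')| ≤
      (4 * δ + 4 * √(2 * δ)) * Real.logb 2 (Fintype.card A)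
        + 2 * OneWayKey.binaryEntropy δ + 2 * OneWayKey.binaryEntropy (√(2 * δ)) := by
  have h1 := OneWayKey.oneWayKey_le_add hρ hρ' hδ hclose hψ hψ'
  have h2 := OneWayKey.oneWayKey_le_add hρ' hρ hδ
    (by rwa [OneWayKey.traceNorm_sub_comm]) hψ' hψ
  have h0 : 0 ≤ δ := (Finset.sum_nonneg fun i _ => Real.sqrt_nonneg _).trans hclose
  have hs : √(2 * δ) ≤ 1 := Real.sqrt_le_one.mpr (by linarith)
  have hb := Real.binEntropy_nonneg (Real.sqrt_nonneg (2 * δ)) hs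
  have hd : 0 ≤ Real.log (Fintype.card A) := Real.log_natCast_nonneg _
  -- The terms in √(2δ) are pure slack; δ ≤ 1/2 keeps √(2δ) in [0,1], where the binary entropy is
  -- nonnegative.
  have key : 2 * (δ * Real.log (Fintype.card A) + Real.binEntropy δ) / Real.log 2 ≤
      (4 * δ + 4 * √(2 * δ)) * Real.logb 2 (Fintype.card A)
        + 2 * OneWayKey.binaryEntropy δ + 2 * OneWayKey.binaryEntropy (√(2 * δ)) := by
    rw [OneWayKey.binaryEntropy_eq, OneWayKey.binaryEntropy_eq, Real.logb, mul_div_assoc',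
      mul_div_assoc', mul_div_assoc', ← add_div, ← add_div]
    refine div_le_div_of_nonneg_right ?_ (Real.log_nonneg one_le_two)
    have h3 := mul_nonneg h0 hd
    have h4 := mul_nonneg (Real.sqrt_nonneg (2 * δ)) hd
    linarith
  rw [abs_le]
  constructor <;> linarith
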